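/- Consider systems $x_{n+1}=f(x_n)$, where $f$ is a differentiable map of a bounded interval $I\subset\mathbb R$ into itself. A 2-cycle of $f$ is a pair $(\eta_1,\eta_2)$ of distinct points of $I$ with $f(\eta_1)=\eta_2$, $f(\eta_2)=\eta_1$; its multiplier is $f'(\eta_1)f'(\eta_2)$. For an integer $N\ge 1$, a delayed-feedback control of prehistory depth $2(N-1)$ is given by real gains $\varepsilon_1,\dots,\varepsilon_{N-1}$ with $|\varepsilon_j|<1$; the controlled system is $$x_{n+1}=f(x_n)-\sum_{j=1}^{N-1}\varepsilon_j\bigl(f(x_{n-2j+2})-f(x_{n-2j})\bigr),\qquad n\ge 2(N-1),$$ with initial data $x_0,\dots,x_{2(N-1)}\in I$. The control stabilizes the cycle $(\eta_1,\eta_2)$ if the periodic solution $\eta_1,\eta_2,\eta_1,\eta_2,\dots$ of the controlled system is locally asymptotically stable, that is, Lyapunov stable (solutions starting in $I$ close enough to it stay in $I$ and close to it) and locally attractive. Let $\mu^*>1$ and let $N_0$ be the smallest integer with $\sqrt{\mu^*}<N_0$. Then there is a control of prehistory depth $N^*=2(N_0-1)$ that stabilizes every 2-cycle, with multiplier in $(-\mu^*,-1)$,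 of every differentiable self-map of a bounded interval. If $\mu^*\neq 4$, this depth is minimal: no control of smaller prehistory depth stabilizes all these cycles. If $\mu^*=4$, the minimal prehistory depth of a control that stabilizes all these cycles is $2$. -/

import Mathlib

/-- `(η₁, η₂)` is a 2-cycle of the map `f`, which is given on the set `I`. -/
structure IsTwoCycle (f : ℝ → ℝ) (I : Set ℝ) (η₁ η₂ : ℝ) : Prop where
  mem₁ : η₁ ∈ I
  mem₂ : η₂ ∈ I
  ne : η₁ ≠ η₂
  map₁ : f η₁ = η₂
  map₂ : f η₂ = η₁

/-- The delayed-feedback control with gains `ε₁, …, ε_K` (here `ε 0, …, ε (K - 1)`):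
`u_n = - ∑_{j=1}^{K} ε_j (f (x_{n-2j+2}) - f (x_{n-2j}))`.
It looks back `2 K` steps and is only used at times `n ≥ 2 K`. -/
noncomputable def feedbackControl (f : ℝ → ℝ) {K : ℕ} (ε : Fin K → ℝ) (x : ℕ → ℝ) (n : ℕ) : ℝ :=
  -∑ j : Fin K, ε j * (f (x (n - 2 * (j : ℕ))) - f (x (n - 2 * ((j : ℕ) + 1))))

/-- `x` is a solution of the closed-loop system `x_{n+1} = f (x_n) + u_n`; its initial data are
`x_0, …, x_{2K}`. -/
def IsClosedLoop (f : ℝ → ℝ) {K : ℕ} (ε : Fin K → ℝ) (x : ℕ → ℝ) : Prop :=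
  ∀ n : ℕ, 2 * K ≤ n → x (n + 1) = f (x n) + feedbackControl f ε x n

/-- The periodic sequence `η₁, η₂, η₁, η₂, …`. -/
noncomputable def cycleSeq (η₁ η₂ : ℝ) (n : ℕ) : ℝ := if Even n then η₁ else η₂

/-- The cycle `(η₁, η₂)` of `f : I → I` is a locally asymptotically stable solution of the
closed-loop system: it is Lyapunov stable (solutions with initial data in `I` close to the cycle
stay in the domain `I` of `f` and remain close to the cycle) and locally attractive. -/
def LocallyAsymptoticallyStabilizes (f : ℝ → ℝ) (I : Set ℝ) {K : ℕ} (ε : Fin K → ℝ)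
    (η₁ η₂ : ℝ) : Prop :=
  (∀ r : ℝ, 0 < r → ∃ δ : ℝ, 0 < δ ∧ ∀ x : ℕ → ℝ, IsClosedLoop f ε x →
      (∀ i : ℕ, i ≤ 2 * K → x i ∈ I ∧ |x i - cycleSeq η₁ η₂ i| < δ) →
      ∀ n : ℕ, x n ∈ I ∧ |x n - cycleSeq η₁ η₂ n| < r) ∧
  (∃ δ : ℝ, 0 < δ ∧ ∀ x : ℕ → ℝ, IsClosedLoop f ε x →
      (∀ i : ℕ, i ≤ 2 * K → x i ∈ I ∧ |x i - cycleSeq η₁ η₂ i| < δ) →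
      Filter.Tendsto (fun n => x n - cycleSeq η₁ η₂ n) Filter.atTop (nhds 0))

/-- The control with gains `ε` locally asymptotically stabilizes every 2-cycle, with multiplier in
`(-μs, -1)`, of every differentiable self-map of a bounded interval. -/
def StabilizesAllCycles (μs : ℝ) {K : ℕ} (ε : Fin K → ℝ) : Prop :=
  ∀ (I : Set ℝ) (f : ℝ → ℝ) (η₁ η₂ : ℝ),
    I.OrdConnected → Bornology.IsBounded I → Set.MapsTo f I I → DifferentiableOn ℝ f I →
    IsTwoCycle f I η₁ η₂ →
    derivWithin f I η₁ * derivWithin f I η₂ ∈ Set.Ioo (-μs) (-1) →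
    LocallyAsymptoticallyStabilizes f I ε η₁ η₂

/-- The prehistory depths `2 (N - 1)`, `N ≥ 1`, of the controls with gains
`ε₁, …, ε_{N-1}`, `|ε_j| < 1`, that stabilize all 2-cycles with multiplier in `(-μs, -1)`. -/
def stabilizingDepths (μs : ℝ) : Set ℕ :=
  {d | ∃ N : ℕ, 1 ≤ N ∧ d = 2 * (N - 1) ∧
    ∃ ε : Fin (N - 1) → ℝ, (∀ j, |ε j| < 1) ∧ StabilizesAllCycles μs ε}

/-! ### The closed loop as a weighted average, and its transfer function -/

open Polynomial

/-! Abel summation writes the closed loop as `x_{n+1} = ∑ weight_j f(x_{n-2j})` with weights of sum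
one. Linearized at a cycle, and with the deviations at odd times rescaled, it becomes a recurrence
with constant coefficients; its characteristic roots `λ` satisfy `μ P(λ⁻¹)² = 1`, where `P` is
`transfer` and `μ` the multiplier. For `μ` in `(-μs, -1)` stability thus concerns one odd polynomial
with `P(1) = 1`: its image of the closed unit disc must avoid the points `± i v` with `b < v < 1`,
where `b = 1/√μs` (`TransferAvoids`). For nonnegative weights this suffices
(`stabilizesAllCycles_of_transferAvoids`); it is always necessary, as a map that is affine near its
cycle shows (`transferAvoids_of_stabilizesAllCycles`).

Existence. Let `N = K + 1`. The normalized Fejér polynomial has real part `cos t (sin Nt / sin t)² /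
N²` on the unit circle, hence nonnegative real part on the right half-disc by the maximum principle,
and modulus at most `1/N` on the imaginary diameter. Mixing in a small multiple of `w` makes the
real part strictly positive and raises the height slightly, which `√μs < N` allows. For `N = 2` the
real part is strictly positive without mixing, so `μs = 4` needs only depth 2.

Minimality. Let `b ≤ 1/N` and follow `P(exp(it))` for `0 ≤ t ≤ π/2` with `x = cos 2t`. Zeros of
`crossPoly` are meetings with the imaginary axis, `x = -1` being the endpoint. The engine is a
quadrature (`sampleMean_of_crossPoly_eq`): the quotient of `crossPoly` by `X - x` at a zero `x`,
averaged over the `N` points `cos(2πj/N)`, is the height there divided by `sin t`. Without sign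
changes in `(-1, 1)` the quotient at `x = -1` is nonnegative, and its value at the node 1 alone
forces a final height of at least `1/N`. In general, a continuous argument about an omitted point `i
y` shows that at least half of the sign changes turn clockwise (`exists_crossing_data`). A
nonnegative test polynomial with double zeros at the other ones gives a weighted quadrature
(`sum_crossing_identity`) with nonnegative right side, to which each clockwise crossing contributes
a negative term: it lies either at height at most `b`, or at height at least 1, where `|ε_j| ≤ 1`
enters through `lt_heightFun_of_derivative_nonpos`. So there are no sign changes and equality holds
throughout (`crossings_eq_empty`). For `N ≥ 3` the curve then touches the axis at the first node at
a forbidden height, which leaves `N = 2`, `b = 1/2`. -/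

/-- The gains with `1` in front and zeros behind. -/
def gainSeq {K : ℕ} (ε : Fin K → ℝ) : ℕ → ℝ
  | 0 => 1
  | j + 1 => if h : j < K then ε ⟨j, h⟩ else 0

/-- The weights of the controlled system written as `x_{n+1} = ∑ j, weight j * f (x_{n-2j})`. -/
def weight {K : ℕ} (ε : Fin K → ℝ) (j : ℕ) : ℝ := gainSeq ε j - gainSeq ε (j + 1)

theorem sum_range_by_parts {E : Type*} [AddCommGroup E] [Module ℝ E] (e : ℕ → ℝ) (g : ℕ → E)
    (K : ℕ) :
    e 0 • g 0 - ∑ j ∈ Finset.range K, e (j + 1) • (g j - g (j + 1)) =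
      ∑ j ∈ Finset.range K, (e j - e (j + 1)) • g j + e K • g K := by
  induction K with
  | zero => simp
  | succ K ih =>
    rw [Finset.sum_range_succ, Finset.sum_range_succ, ← sub_sub, ih]
    module

/-- Abel summation: the leading gain 1 accounts for the uncontrolled term, the trailing 0 for the
oldest delay. -/
theorem sub_sum_gain_eq_sum_weight {E : Type*} [AddCommGroup E] [Module ℝ E] {K : ℕ}
    (ε : Fin K → ℝ) (g : ℕ → E) :
    g 0 - ∑ j : Fin K, ε j • (g j - g (j + 1)) =
      ∑ j ∈ Finset.range (K + 1), weight ε j • g j := by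
  have h := sum_range_by_parts (gainSeq ε) g K
  have h0 : gainSeq ε (K + 1) = 0 := by simp [gainSeq]
  have h1 : ∑ j ∈ Finset.range K, gainSeq ε (j + 1) • (g j - g (j + 1)) =
      ∑ j : Fin K, ε j • (g j - g (j + 1)) := by
    rw [Finset.sum_range]
    refine Finset.sum_congr rfl fun j _ => ?_
    simp [gainSeq]
  rw [h1] at h
  rw [Finset.sum_range_succ, weight, h0, sub_zero]
  simpa [weight, gainSeq] using h

theorem sum_weight {K : ℕ} (ε : Fin K → ℝ) : ∑ j ∈ Finset.range (K + 1), weight ε j = 1 := by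
  simpa using (sub_sum_gain_eq_sum_weight ε (fun _ => (1 : ℝ))).symm

/-- The characteristic function of the control: the linearized closed loop at a cycle of
multiplier `μ` has a solution `λ ^ n` (up to rescaling) iff `μ * transfer ε λ⁻¹ ^ 2 = 1`. -/
noncomputable def transfer {K : ℕ} (ε : Fin K → ℝ) (w : ℂ) : ℂ :=
  w + ∑ j : Fin K, (ε j : ℂ) * (w ^ (2 * (j : ℕ) + 3) - w ^ (2 * (j : ℕ) + 1))

theorem transfer_eq_sum_weight {K : ℕ} (ε : Fin K → ℝ) (w : ℂ) :
    transfer ε w = ∑ j ∈ Finset.range (K + 1), (weight ε j : ℂ) * w ^ (2 * j + 1) := by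
  have h := sub_sum_gain_eq_sum_weight ε (fun j => w ^ (2 * j + 1))
  simp only [Complex.real_smul] at h
  rw [← h, transfer, sub_eq_add_neg, ← Finset.sum_neg_distrib]
  congr 1
  · ring
  · refine Finset.sum_congr rfl fun j _ => ?_
    ring

/-- The closed loop linearized at a cycle with multiplier in `(-μs, -1)` has no
characteristic root of modulus at least `1`. -/
def TransferAvoids {K : ℕ} (ε : Fin K → ℝ) (μs : ℝ) : Prop :=
  ∀ w : ℂ, ‖w‖ ≤ 1 → ∀ μ ∈ Set.Ioo (-μs) (-1), (μ : ℂ) * transfer ε w ^ 2 ≠ 1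

theorem closedLoop_eq_sum_weight {f : ℝ → ℝ} {K : ℕ} {ε : Fin K → ℝ} {x : ℕ → ℝ}
    (hx : IsClosedLoop f ε x) {n : ℕ} (hn : 2 * K ≤ n) :
    x (n + 1) = ∑ j ∈ Finset.range (K + 1), weight ε j * f (x (n - 2 * j)) := by
  have h := sub_sum_gain_eq_sum_weight ε (fun j => f (x (n - 2 * j)))
  simp only [smul_eq_mul] at h
  rw [← h, hx n hn, feedbackControl]
  simp [sub_eq_add_neg]

/-! ### Linear recurrences -/

/-- The backward shift of sequences. -/
noncomputable def seqShift : (ℕ → ℂ) →ₗ[ℂ] (ℕ → ℂ) := LinearMap.funLeft ℂ ℂ Nat.succ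

theorem seqShift_apply (y : ℕ → ℂ) (n : ℕ) : seqShift y n = y (n + 1) := rfl

theorem seqShift_pow_apply (k : ℕ) (y : ℕ → ℂ) (n : ℕ) : (seqShift ^ k) y n = y (n + k) := by
  induction k generalizing y n with
  | zero => simp
  | succ k ih => rw [pow_succ, Module.End.mul_apply, ih, seqShift_apply]; congr 1

theorem norm_le_of_first_order {θ : ℝ} (hθ : 0 < θ) {l : ℂ} {y : ℕ → ℂ} {n : ℕ} {A M : ℝ}
    (h0 : ‖y 0‖ ≤ M) (hM : M * ‖l‖ + A ≤ M * θ)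
    (h : ∀ m < n, ‖y (m + 1) - l * y m‖ ≤ A * θ ^ m) : ∀ m < n + 1, ‖y m‖ ≤ M * θ ^ m := by
  intro m
  induction m with
  | zero => intro _; simpa using h0
  | succ m ih =>
    intro hm
    have h1 := ih (by omega)
    have h2 := h m (by omega)
    have h3 : ‖y (m + 1)‖ ≤ ‖y (m + 1) - l * y m‖ + ‖l‖ * ‖y m‖ := by
      calc ‖y (m + 1)‖ = ‖(y (m + 1) - l * y m) + l * y m‖ := by ring_nf
        _ ≤ _ := by rw [← norm_mul]; exact norm_add_le _ _
    have h4 : ‖l‖ * ‖y m‖ ≤ ‖l‖ * (M * θ ^ m) := by gcongr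
    have h5 : (M * ‖l‖ + A) * θ ^ m ≤ M * θ * θ ^ m := by gcongr
    rw [pow_succ]
    linarith

/-- Induction on the roots: `y (m + 1) - l * y m` obeys the recurrence of the remaining factors, and
its bound serves as the error of a first-order recurrence with root `l`. That `M` does not depend on
the horizon `n` is what permits a bootstrap later. -/
theorem exists_bound_of_roots {θ : ℝ} (hθ : 0 < θ) (hθ1 : θ ≤ 1) (s : Multiset ℂ)
    (hs : ∀ l ∈ s, ‖l‖ < θ) : ∃ M : ℝ, 1 ≤ M ∧ ∀ (y : ℕ → ℂ) (n : ℕ) (B : ℝ), 0 ≤ B →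
      (∀ m < Multiset.card s, ‖y m‖ ≤ B * θ ^ m) →
      (∀ m < n, ‖aeval seqShift (s.map fun l => X - C l).prod y m‖ ≤ B * θ ^ m) →
      ∀ m < n + Multiset.card s, ‖y m‖ ≤ M * B * θ ^ m := by
  induction s using Multiset.induction_on with
  | empty =>
    refine ⟨1, le_rfl, fun y n B hB _ h m hm => ?_⟩
    simpa using h m (by simpa using hm)
  | cons l s ih =>
    obtain ⟨M', hM', h'⟩ := ih fun l hl => hs l (Multiset.mem_cons_of_mem hl)
    have hl : ‖l‖ < θ := hs l (Multiset.mem_cons_self l s)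
    -- The 2 bounds the initial values of `u`, differences of two terms of size at most `B * θ ^ m`;
    -- the denominator comes from the geometric series of the first-order step.
    refine ⟨max 1 (2 * M' / (θ - ‖l‖)), le_max_left _ _, fun y n B hB hinit herr => ?_⟩
    set M := max 1 (2 * M' / (θ - ‖l‖))
    have hM : 2 * M' ≤ M * (θ - ‖l‖) := by
      rw [← div_le_iff₀ (by linarith)]; exact le_max_right _ _
    have hM1 : 1 ≤ M := le_max_left _ _
    set u : ℕ → ℂ := fun m => y (m + 1) - l * y m with hu
    have hu' : aeval seqShift (X - C l : ℂ[X]) y = u := by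
      ext m; simp [hu, seqShift_apply]
    have hprod : aeval seqShift ((l ::ₘ s).map fun l => X - C l).prod y =
        aeval seqShift (s.map fun l => X - C l).prod u := by
      rw [Multiset.map_cons, Multiset.prod_cons, mul_comm, map_mul, Module.End.mul_apply, hu']
    rw [hprod] at herr
    have hub : ∀ m < Multiset.card s, ‖u m‖ ≤ 2 * B * θ ^ m := by
      intro m hm
      have h1 := hinit m (by rw [Multiset.card_cons]; omega)
      have h2 := hinit (m + 1) (by rw [Multiset.card_cons]; omega)
      have h3 : ‖l * y m‖ ≤ 1 * (B * θ ^ m) := by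
        rw [norm_mul]; gcongr; linarith
      have h4 : B * θ ^ (m + 1) ≤ B * θ ^ m := by
        gcongr B * ?_; exact pow_le_pow_of_le_one hθ.le hθ1 (by omega)
      calc ‖u m‖ ≤ ‖y (m + 1)‖ + ‖l * y m‖ := norm_sub_le _ _
        _ ≤ _ := by linarith
    have hu2 := h' u n (2 * B) (by positivity) hub fun m hm => (herr m hm).trans (by
      have : 0 ≤ B * θ ^ m := by positivity
      linarith)
    intro m hm
    have h0 : ‖y 0‖ ≤ B := by
      simpa using hinit 0 (by rw [Multiset.card_cons]; omega)
    refine norm_le_of_first_order hθ (l := l) (n := n + Multiset.card s)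
      (A := M' * (2 * B)) ?_ ?_ hu2 m (by rw [Multiset.card_cons] at hm; omega)
    · nlinarith
    · nlinarith

theorem exists_lt_one_of_forall_norm_lt_one (s : Multiset ℂ) (hs : ∀ l ∈ s, ‖l‖ < 1) :
    ∃ θ : ℝ, 0 < θ ∧ θ < 1 ∧ ∀ l ∈ s, ‖l‖ < θ := by
  induction s using Multiset.induction_on with
  | empty => exact ⟨1 / 2, by norm_num, by norm_num, by simp⟩
  | cons l s ih =>
    obtain ⟨θ, h0, h1, h⟩ := ih fun l hl => hs l (Multiset.mem_cons_of_mem hl)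
    have hl : ‖l‖ < 1 := hs l (Multiset.mem_cons_self l s)
    obtain ⟨q, hq, hq1⟩ := exists_between (max_lt h1 hl)
    refine ⟨q, h0.trans ((le_max_left _ _).trans_lt hq), hq1, fun a ha => ?_⟩
    rcases Multiset.mem_cons.1 ha with rfl | ha
    · exact (le_max_right _ _).trans_lt hq
    · exact (h a ha).trans ((le_max_left _ _).trans_lt hq)

/-- A delayed recurrence `y_{n+1} = ν ∑ a_j y_{n-2j}` without characteristic roots of modulus at
least `1` is exponentially stable under exponentially small errors. -/
theorem exists_bound_of_transfer_ne {K : ℕ} (a : ℕ → ℂ) (ν : ℂ)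
    (h : ∀ w : ℂ, ‖w‖ ≤ 1 → ν * ∑ j ∈ Finset.range (K + 1), a j * w ^ (2 * j + 1) ≠ 1) :
    ∃ θ : ℝ, 0 < θ ∧ θ < 1 ∧ ∃ M : ℝ, 1 ≤ M ∧ ∀ (y : ℕ → ℂ) (n : ℕ) (B : ℝ), 0 ≤ B →
      (∀ m < 2 * K + 1, ‖y m‖ ≤ B * θ ^ m) →
      (∀ m < n, ‖y (m + (2 * K + 1)) -
        ν * ∑ j ∈ Finset.range (K + 1), a j * y (m + (2 * K - 2 * j))‖ ≤ B * θ ^ m) →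
      ∀ m < n + (2 * K + 1), ‖y m‖ ≤ M * B * θ ^ m := by
  -- `p = X ^ (2K+1) - g` is the characteristic polynomial; a root `l` with `1 ≤ ‖l‖` would make `w
  -- = l⁻¹` violate `h`.
  set g : ℂ[X] := ∑ j ∈ Finset.range (K + 1), C (ν * a j) * X ^ (2 * K - 2 * j) with hg
  set p : ℂ[X] := X ^ (2 * K + 1) - g with hp
  have hgdeg : g.degree < (2 * K + 1 : ℕ) := by
    refine (degree_sum_le _ _).trans_lt ?_
    rw [Finset.sup_lt_iff (by exact WithBot.bot_lt_coe _)]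
    intro j _
    refine (degree_C_mul_X_pow_le _ _).trans_lt ?_
    exact_mod_cast (by omega : 2 * K - 2 * j < 2 * K + 1)
  have hmonic : p.Monic := monic_X_pow_sub hgdeg
  have hdeg : p.natDegree = 2 * K + 1 := by
    have : p.degree = (2 * K + 1 : ℕ) := by
      rw [hp, degree_sub_eq_left_of_degree_lt] <;> simp only [degree_X_pow]
      exact hgdeg
    exact natDegree_eq_of_degree_eq_some this
  have hsplit := (IsAlgClosed.splits p).eq_prod_roots
  rw [hmonic.leadingCoeff, C_1, one_mul] at hsplit
  have hcard : Multiset.card p.roots = 2 * K + 1 := by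
    rw [← hdeg]; exact (IsAlgClosed.splits p).natDegree_eq_card_roots.symm
  have hroots : ∀ l ∈ p.roots, ‖l‖ < 1 := by
    intro l hl
    by_contra hl1
    rw [not_lt] at hl1
    have hl0 : l ≠ 0 := by rintro rfl; norm_num at hl1
    have hev : p.eval l = 0 := (mem_roots hmonic.ne_zero).1 hl
    refine h l⁻¹ (by rw [norm_inv]; exact inv_le_one_of_one_le₀ hl1) ?_
    simp only [hp, hg, eval_sub, eval_pow, eval_X, eval_mul, eval_C, eval_finsetSum, mul_assoc, ← Finset.mul_sum] at hev
    have hpow : l ^ (2 * K + 1) ≠ 0 := pow_ne_zero _ hl0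
    apply mul_left_cancel₀ hpow
    rw [mul_one]
    refine Eq.trans ?_ (sub_eq_zero.1 hev).symm
    rw [mul_left_comm, Finset.mul_sum]
    congr 1
    refine Finset.sum_congr rfl fun j hj => ?_
    have hj' : j < K + 1 := Finset.mem_range.1 hj
    have : l ^ (2 * K + 1) = l ^ (2 * K - 2 * j) * l ^ (2 * j + 1) := by
      rw [← pow_add]; congr 1; omega
    rw [this, inv_pow]
    field_simp
  obtain ⟨θ, h0, h1, hθ⟩ := exists_lt_one_of_forall_norm_lt_one p.roots hroots
  obtain ⟨M, hM, hb⟩ := exists_bound_of_roots h0 h1.le p.roots hθ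
  refine ⟨θ, h0, h1, M, hM, fun y n B hB hinit herr => ?_⟩
  rw [hcard, ← hsplit] at hb
  refine hb y n B hB hinit fun m hm => ?_
  have : aeval seqShift p y m = y (m + (2 * K + 1)) -
        ν * ∑ j ∈ Finset.range (K + 1), a j * y (m + (2 * K - 2 * j)) := by
    simp only [hp, hg, map_sub, map_mul, map_sum, aeval_C, aeval_X_pow, LinearMap.sub_apply,
      Pi.sub_apply, seqShift_pow_apply, Module.End.mul_apply, Module.algebraMap_end_apply,
      LinearMap.sum_apply, Pi.smul_apply, Finset.sum_apply, smul_eq_mul, mul_assoc,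
      Finset.mul_sum]
  rw [this]
  exact herr m hm

/-! ### Stability of the controlled cycle -/

theorem cycleSeq_sub_two_mul (η₁ η₂ : ℝ) {n k : ℕ} (h : 2 * k ≤ n) :
    cycleSeq η₁ η₂ (n - 2 * k) = cycleSeq η₁ η₂ n := by
  have : Even (n - 2 * k) ↔ Even n := by
    rw [Nat.even_sub h]; simp
  simp [cycleSeq, this]

theorem IsTwoCycle.map_cycleSeq {f : ℝ → ℝ} {I : Set ℝ} {η₁ η₂ : ℝ} (h : IsTwoCycle f I η₁ η₂)
    (n : ℕ) : f (cycleSeq η₁ η₂ n) = cycleSeq η₁ η₂ (n + 1) := by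
  by_cases hn : Even n
  · simp [cycleSeq, hn, Nat.even_add_one, h.map₁]
  · simp [cycleSeq, hn, Nat.even_add_one, h.map₂]

theorem HasDerivWithinAt.exists_abs_sub_le {f : ℝ → ℝ} {I : Set ℝ} {η c : ℝ}
    (h : HasDerivWithinAt f c I η) {τ : ℝ} (hτ : 0 < τ) :
    ∃ ρ > 0, ∀ x ∈ I, |x - η| < ρ → |f x - f η - c * (x - η)| ≤ τ * |x - η| := by
  have h1 := (hasDerivWithinAt_iff_isLittleO.1 h).def hτ
  obtain ⟨ρ, hρ, h2⟩ := Metric.eventually_nhds_iff.1 (eventually_nhdsWithin_iff.1 h1)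
  refine ⟨ρ, hρ, fun x hx hxρ => ?_⟩
  have h3 := h2 (by rwa [Real.dist_eq]) hx
  simpa [mul_comm] using h3

theorem abs_sum_weight_mul_le {K : ℕ} {ε : Fin K → ℝ} (hw : ∀ j ≤ K, 0 ≤ weight ε j)
    {g : ℕ → ℝ} {A : ℝ} (hg : ∀ j ≤ K, |g j| ≤ A) :
    |∑ j ∈ Finset.range (K + 1), weight ε j * g j| ≤ A := by
  calc _ ≤ ∑ j ∈ Finset.range (K + 1), weight ε j * A := by
        refine (Finset.abs_sum_le_sum_abs _ _).trans (Finset.sum_le_sum fun j hj => ?_)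
        have hj' : j ≤ K := Nat.lt_succ_iff.1 (Finset.mem_range.1 hj)
        rw [abs_mul, abs_of_nonneg (hw j hj')]
        exact mul_le_mul_of_nonneg_left (hg j hj') (hw j hj')
    _ = A := by rw [← Finset.sum_mul, sum_weight, one_mul]

/-- One step of the closed loop near the cycle: it stays in the interval and is close to its
linearization. -/
theorem closedLoop_step {f : ℝ → ℝ} {I : Set ℝ} {η₁ η₂ : ℝ} {K : ℕ} {ε : Fin K → ℝ}
    (hw : ∀ j ≤ K, 0 ≤ weight ε j) (hI : I.OrdConnected) (hf : Set.MapsTo f I I)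
    (hcyc : IsTwoCycle f I η₁ η₂) {c τ ρ A : ℝ} (hτ : 0 ≤ τ) {x : ℕ → ℝ}
    (hx : IsClosedLoop f ε x) {n : ℕ} (hn : 2 * K ≤ n)
    (hlin : ∀ z ∈ I, |z - cycleSeq η₁ η₂ n| < ρ →
      |f z - f (cycleSeq η₁ η₂ n) - c * (z - cycleSeq η₁ η₂ n)| ≤ τ * |z - cycleSeq η₁ η₂ n|)
    (hmem : ∀ j ≤ K, x (n - 2 * j) ∈ I) (hA : A < ρ)
    (hclose : ∀ j ≤ K, |x (n - 2 * j) - cycleSeq η₁ η₂ (n - 2 * j)| ≤ A) :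
    x (n + 1) ∈ I ∧ |x (n + 1) - cycleSeq η₁ η₂ (n + 1) - c * ∑ j ∈ Finset.range (K + 1),
      weight ε j * (x (n - 2 * j) - cycleSeq η₁ η₂ (n - 2 * j))| ≤ τ * A := by
  have hrange : ∀ {j}, j ∈ Finset.range (K + 1) → j ≤ K := fun hj =>
    Nat.lt_succ_iff.1 (Finset.mem_range.1 hj)
  rw [closedLoop_eq_sum_weight hx hn]
  constructor
  -- Nonnegative weights of sum one make `x (n + 1)` a convex combination of values of `f` in `I`.
  · have := (hI.convex (𝕜 := ℝ)).sum_mem (t := Finset.range (K + 1)) (w := weight ε)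
      (z := fun j => f (x (n - 2 * j))) (fun j hj => hw j (hrange hj)) (sum_weight ε)
      (fun j hj => hf (hmem j (hrange hj)))
    simpa using this
  · have hcy : ∀ j ≤ K, cycleSeq η₁ η₂ (n - 2 * j) = cycleSeq η₁ η₂ n := fun j hj =>
      cycleSeq_sub_two_mul _ _ (by omega)
    have : ∑ j ∈ Finset.range (K + 1), weight ε j * f (x (n - 2 * j)) - cycleSeq η₁ η₂ (n + 1) -
        c * ∑ j ∈ Finset.range (K + 1),
          weight ε j * (x (n - 2 * j) - cycleSeq η₁ η₂ (n - 2 * j)) =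
        ∑ j ∈ Finset.range (K + 1), weight ε j * (f (x (n - 2 * j)) - f (cycleSeq η₁ η₂ n) -
          c * (x (n - 2 * j) - cycleSeq η₁ η₂ n)) := by
      have h1 : cycleSeq η₁ η₂ (n + 1) =
          ∑ j ∈ Finset.range (K + 1), weight ε j * cycleSeq η₁ η₂ (n + 1) := by
        rw [← Finset.sum_mul, sum_weight, one_mul]
      rw [h1, Finset.mul_sum, ← Finset.sum_sub_distrib, ← Finset.sum_sub_distrib]
      refine Finset.sum_congr rfl fun j hj => ?_
      rw [hcy j (hrange hj), hcyc.map_cycleSeq n]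
      ring
    rw [this]
    refine abs_sum_weight_mul_le hw fun j hj => ?_
    have h2 := hclose j hj
    rw [hcy j hj] at h2
    exact (hlin _ (hmem j hj) (h2.trans_lt hA)).trans (by gcongr)

/-- A bootstrap: while the decay bound holds, differentiability at the two cycle points keeps the
linearization error below `B * θ ^ n`, the error that the linear estimate tolerates, and that
estimate extends the bound by one step. -/
theorem exists_exponential_bound {μs : ℝ} {K : ℕ} {ε : Fin K → ℝ}
    (hw : ∀ j ≤ K, 0 ≤ weight ε j) (hav : TransferAvoids ε μs) {I : Set ℝ} {f : ℝ → ℝ}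
    {η₁ η₂ : ℝ} (hI : I.OrdConnected) (hf : Set.MapsTo f I I) (hd : DifferentiableOn ℝ f I)
    (hcyc : IsTwoCycle f I η₁ η₂)
    (hμ : derivWithin f I η₁ * derivWithin f I η₂ ∈ Set.Ioo (-μs) (-1)) :
    ∃ θ : ℝ, 0 < θ ∧ θ < 1 ∧ ∃ G > 0, ∃ δ₀ > 0, ∀ δ : ℝ, 0 < δ → δ ≤ δ₀ → ∀ x : ℕ → ℝ,
      IsClosedLoop f ε x →
      (∀ i : ℕ, i ≤ 2 * K → x i ∈ I ∧ |x i - cycleSeq η₁ η₂ i| < δ) →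
      ∀ n : ℕ, x n ∈ I ∧ |x n - cycleSeq η₁ η₂ n| ≤ G * δ * θ ^ n := by
  set c₁ := derivWithin f I η₁ with hc₁
  set c₂ := derivWithin f I η₂ with hc₂
  have hc₁0 : c₁ ≠ 0 := by
    intro h0; have := hμ.2; rw [h0] at this; norm_num at this
  have hc₂0 : c₂ ≠ 0 := by
    intro h0; have := hμ.2; rw [h0] at this; norm_num at this
  -- Multiplying odd-time deviations by `κ` turns the alternating slopes into the single coefficient
  -- `ν = κ c₁`, with `ν² = c₁ c₂`. As the multiplier is negative, `κ` is not real.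
  obtain ⟨κ, hκ⟩ := IsSquare.exists_sq ((c₂ : ℂ) / c₁) (IsAlgClosed.exists_eq_mul_self _)
  have hc₁C : (c₁ : ℂ) ≠ 0 := by exact_mod_cast hc₁0
  have hc₂C : (c₂ : ℂ) ≠ 0 := by exact_mod_cast hc₂0
  have hκ0 : κ ≠ 0 := by
    rintro rfl
    have : (c₂ : ℂ) / c₁ ≠ 0 := div_ne_zero hc₂C hc₁C
    exact this (by rw [hκ]; simp)
  have hκ2 : κ ^ 2 * c₁ = c₂ := by rw [← hκ]; field_simp
  set ν : ℂ := κ * c₁ with hν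
  have hνne : ∀ w : ℂ, ‖w‖ ≤ 1 →
      ν * ∑ j ∈ Finset.range (K + 1), (weight ε j : ℂ) * w ^ (2 * j + 1) ≠ 1 := by
    intro w hw1 h1
    rw [← transfer_eq_sum_weight] at h1
    refine hav w hw1 _ hμ ?_
    have h2 : (ν * transfer ε w) ^ 2 = 1 := by rw [h1]; simp
    rw [← h2, hν]
    push_cast
    rw [← hκ2]
    ring
  obtain ⟨θ, hθ0, hθ1, M, hM, hb⟩ := exists_bound_of_transfer_ne _ ν hνne
  set sc : ℕ → ℂ := fun n => if Even n then 1 else κ with hsc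
  set cc : ℕ → ℝ := fun n => if Even n then c₁ else c₂ with hcc
  have hstep : ∀ n, sc (n + 1) * cc n = ν * sc n := by
    intro n
    by_cases hn : Even n
    · simp [hsc, hcc, hn, Nat.even_add_one, hν]
    · simp only [hsc, hcc, hn, Nat.even_add_one, hν, if_false, not_false_eq_true, if_true]
      rw [← hκ2]; ring
  have hsc2 : ∀ n k, 2 * k ≤ n → sc (n - 2 * k) = sc n := by
    intro n k h
    have : Even (n - 2 * k) ↔ Even n := by rw [Nat.even_sub h]; simp
    simp [hsc, this]
  have hκn : 0 < ‖κ‖ := norm_pos_iff.2 hκ0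
  set U := max 1 ‖κ‖ with hU
  set Lo := min 1 ‖κ‖ with hLo
  have hU0 : 0 < U := lt_max_of_lt_left one_pos
  have hLo0 : 0 < Lo := lt_min one_pos hκn
  have hscU : ∀ n, ‖sc n‖ ≤ U := by
    intro n; by_cases hn : Even n <;> simp [hsc, hn, hU]
  have hscL : ∀ n, Lo ≤ ‖sc n‖ := by
    intro n; by_cases hn : Even n <;> simp [hsc, hn, hLo]
  -- Chosen so that `U * (τ * (G * δ * θ ^ n))` is exactly `B * θ ^ n` for the constants `G` and `B`
  -- below.
  set τ := Lo / (U * M) with hτ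
  have hM0 : 0 < M := by linarith
  have hτ0 : 0 < τ := by positivity
  obtain ⟨ρ₁, hρ₁, h₁⟩ := (hd η₁ hcyc.mem₁).hasDerivWithinAt.exists_abs_sub_le hτ0
  obtain ⟨ρ₂, hρ₂, h₂⟩ := (hd η₂ hcyc.mem₂).hasDerivWithinAt.exists_abs_sub_le hτ0
  set ρ := min ρ₁ ρ₂ with hρ
  have hρ0 : 0 < ρ := lt_min hρ₁ hρ₂
  have hlin : ∀ n, ∀ z ∈ I, |z - cycleSeq η₁ η₂ n| < ρ →
      |f z - f (cycleSeq η₁ η₂ n) - cc n * (z - cycleSeq η₁ η₂ n)| ≤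
        τ * |z - cycleSeq η₁ η₂ n| := by
    intro n z hz hzn
    by_cases hn : Even n
    · simp only [cycleSeq, hn, if_true, hcc] at hzn ⊢
      exact h₁ z hz (hzn.trans_le (min_le_left _ _))
    · simp only [cycleSeq, hn, if_false, hcc] at hzn ⊢
      exact h₂ z hz (hzn.trans_le (min_le_right _ _))
  -- The power `θ ^ (2 * K)` pays for dominating the initial data by a multiple of `θ ^ m`; `U` and
  -- `Lo` pay for the rescaling and its inverse.
  set G := M * U / (θ ^ (2 * K) * Lo) with hG
  have hG0 : 0 < G := by positivity
  refine ⟨θ, hθ0, hθ1, G, hG0, ρ / (2 * G), by positivity, ?_⟩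
  intro δ hδ0 hδ x hx hinit
  set dev : ℕ → ℝ := fun n => x n - cycleSeq η₁ η₂ n with hdev
  set Y : ℕ → ℂ := fun n => sc n * dev n with hY
  have hYnorm : ∀ n, ‖Y n‖ = ‖sc n‖ * |dev n| := fun n => by simp [hY]
  set B := U * δ / θ ^ (2 * K) with hB
  have hB0 : 0 < B := by positivity
  have hGB : M * B = G * δ * Lo := by rw [hB, hG]; field_simp
  have hpow : ∀ m ≤ 2 * K, 1 ≤ θ ^ m / θ ^ (2 * K) := by
    intro m hm
    rw [one_le_div (by positivity)]
    exact pow_le_pow_of_le_one hθ0.le hθ1.le hm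
  have hYinit : ∀ m < 2 * K + 1, ‖Y m‖ ≤ B * θ ^ m := by
    intro m hm
    have h1 := (hinit m (by omega)).2
    calc ‖Y m‖ = ‖sc m‖ * |dev m| := hYnorm m
      _ ≤ U * δ := mul_le_mul (hscU m) h1.le (abs_nonneg _) hU0.le
      _ ≤ U * δ * (θ ^ m / θ ^ (2 * K)) :=
        le_mul_of_one_le_right (by positivity) (hpow m (by omega))
      _ = B * θ ^ m := by rw [hB]; ring
  have hdevY : ∀ m, ‖Y m‖ ≤ M * B * θ ^ m → |dev m| ≤ G * δ * θ ^ m := by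
    intro m hm
    rw [hYnorm, hGB] at hm
    have h1 : Lo * |dev m| ≤ ‖sc m‖ * |dev m| := by gcongr; exact hscL m
    have h2 : Lo * |dev m| ≤ Lo * (G * δ * θ ^ m) := by linarith
    exact le_of_mul_le_mul_left h2 hLo0
  have key : ∀ n, (∀ m < n + (2 * K + 1), x m ∈ I ∧ ‖Y m‖ ≤ M * B * θ ^ m) ∧
      ∀ m < n, ‖Y (m + (2 * K + 1)) - ν * ∑ j ∈ Finset.range (K + 1),
        (weight ε j : ℂ) * Y (m + (2 * K - 2 * j))‖ ≤ B * θ ^ m := by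
    intro n
    induction n with
    | zero =>
      refine ⟨fun m hm => ⟨(hinit m (by omega)).1, ?_⟩, fun m hm => absurd hm (by omega)⟩
      refine (hYinit m (by omega)).trans ?_
      have : 0 ≤ B * θ ^ m := by positivity
      nlinarith
    | succ n ih =>
      obtain ⟨ih1, ih2⟩ := ih
      have hA : G * δ * θ ^ n < ρ := by
        have h1 : G * δ ≤ ρ / 2 := by
          calc G * δ ≤ G * (ρ / (2 * G)) := by gcongr
            _ = ρ / 2 := by field_simp
        have h2 : θ ^ n ≤ 1 := pow_le_one₀ hθ0.le hθ1.le
        have h3 : 0 < G * δ := by positivity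
        nlinarith
      -- The bound at the oldest delayed time `n` is the largest in the window and serves for all
      -- delays.
      have hs := closedLoop_step hw hI hf hcyc (c := cc (n + 2 * K)) hτ0.le hx
        (n := n + 2 * K) (by omega) (hlin _) (fun j hj => (ih1 _ (by omega)).1) hA
        (fun j hj => (hdevY _ (ih1 _ (by omega)).2).trans (by
          gcongr G * δ * ?_
          exact pow_le_pow_of_le_one hθ0.le hθ1.le (by omega)))
      have herr : ‖Y (n + (2 * K + 1)) - ν * ∑ j ∈ Finset.range (K + 1),
          (weight ε j : ℂ) * Y (n + (2 * K - 2 * j))‖ ≤ B * θ ^ n := by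
        have heq : Y (n + (2 * K + 1)) - ν * ∑ j ∈ Finset.range (K + 1),
            (weight ε j : ℂ) * Y (n + (2 * K - 2 * j)) = sc (n + 2 * K + 1) *
            ((x (n + 2 * K + 1) - cycleSeq η₁ η₂ (n + 2 * K + 1) - cc (n + 2 * K) *
              ∑ j ∈ Finset.range (K + 1), weight ε j * (x (n + 2 * K - 2 * j) -
                cycleSeq η₁ η₂ (n + 2 * K - 2 * j)) : ℝ) : ℂ) := by
          push_cast
          rw [mul_sub, ← mul_assoc (sc _), hstep, mul_assoc ν, Finset.mul_sum _ _ (sc _)]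
          congr 1
          · simp only [hY, hdev]; push_cast; rfl
          · congr 1
            refine Finset.sum_congr rfl fun j hj => ?_
            have hj' : j < K + 1 := Finset.mem_range.1 hj
            have he : n + (2 * K - 2 * j) = n + 2 * K - 2 * j := by omega
            simp only [hY, hdev, he]
            rw [hsc2 _ _ (by omega)]
            push_cast
            ring
        rw [heq, norm_mul, Complex.norm_real, Real.norm_eq_abs]
        calc _ ≤ U * (τ * (G * δ * θ ^ n)) := mul_le_mul (hscU _) hs.2 (abs_nonneg _) hU0.le
          _ = B * θ ^ n := by
            rw [hτ, hG, hB]; field_simp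
      have herr' : ∀ m < n + 1, ‖Y (m + (2 * K + 1)) - ν * ∑ j ∈ Finset.range (K + 1),
          (weight ε j : ℂ) * Y (m + (2 * K - 2 * j))‖ ≤ B * θ ^ m := by
        intro m hm
        rcases Nat.lt_succ_iff_lt_or_eq.1 hm with h | rfl
        · exact ih2 m h
        · exact herr
      refine ⟨fun m hm => ⟨?_, hb Y (n + 1) B hB0.le hYinit herr' m hm⟩, herr'⟩
      by_cases h : m < n + (2 * K + 1)
      · exact (ih1 m h).1
      · have : m = n + 2 * K + 1 := by omega
        rw [this]; exact hs.1
  intro n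
  have h1 := (key (n + 1)).1 n (by omega)
  exact ⟨h1.1, hdevY n h1.2⟩

/-- A control with nonnegative weights whose transfer function avoids the critical values
stabilizes all cycles. -/
theorem stabilizesAllCycles_of_transferAvoids {μs : ℝ} {K : ℕ} {ε : Fin K → ℝ}
    (hw : ∀ j ≤ K, 0 ≤ weight ε j) (hav : TransferAvoids ε μs) : StabilizesAllCycles μs ε := by
  intro I f η₁ η₂ hI _ hf hd hcyc hμ
  obtain ⟨θ, hθ0, hθ1, G, hG, δ₀, hδ₀, h⟩ :=
    exists_exponential_bound hw hav hI hf hd hcyc hμ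
  constructor
  · intro r hr
    refine ⟨min δ₀ (r / (2 * G)), by positivity, fun x hx hinit n => ?_⟩
    obtain ⟨h1, h2⟩ := h _ (by positivity) (min_le_left _ _) x hx hinit n
    refine ⟨h1, h2.trans_lt ?_⟩
    have h3 : G * min δ₀ (r / (2 * G)) ≤ r / 2 := by
      calc _ ≤ G * (r / (2 * G)) := by gcongr; exact min_le_right _ _
        _ = r / 2 := by field_simp
    have h4 : θ ^ n ≤ 1 := pow_le_one₀ hθ0.le hθ1.le
    have h5 : 0 < G * min δ₀ (r / (2 * G)) := by positivity
    nlinarith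
  · refine ⟨δ₀, hδ₀, fun x hx hinit => ?_⟩
    refine squeeze_zero_norm (fun n => (h _ hδ₀ le_rfl x hx hinit n).2) ?_
    simpa using (tendsto_pow_atTop_nhds_zero_of_lt_one hθ0.le hθ1).const_mul (G * δ₀)

section

open Filter Topology

/-! ### Characteristic roots outside the open disc prevent stabilization -/

theorem feedbackControl_congr {f : ℝ → ℝ} {K : ℕ} {ε : Fin K → ℝ} {x y : ℕ → ℝ} {n : ℕ}
    (h : ∀ m ≤ n, x m = y m) : feedbackControl f ε x n = feedbackControl f ε y n := by
  simp only [feedbackControl]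
  congr 1
  refine Finset.sum_congr rfl fun j _ => ?_
  rw [h _ (Nat.sub_le _ _), h _ (Nat.sub_le _ _)]

/-- The sequence obtained from the initial data `x₀` by `k` steps of the closed loop. -/
noncomputable def closedLoopIter (f : ℝ → ℝ) {K : ℕ} (ε : Fin K → ℝ) (x₀ : ℕ → ℝ) : ℕ → ℕ → ℝ
  | 0 => x₀
  | k + 1 => Function.update (closedLoopIter f ε x₀ k) (2 * K + k + 1)
      (f (closedLoopIter f ε x₀ k (2 * K + k)) +
        feedbackControl f ε (closedLoopIter f ε x₀ k) (2 * K + k))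

theorem closedLoopIter_eq_of_le (f : ℝ → ℝ) {K : ℕ} (ε : Fin K → ℝ) (x₀ : ℕ → ℝ) {m k k' : ℕ}
    (hm : m ≤ 2 * K + k) (hk : k ≤ k') :
    closedLoopIter f ε x₀ k' m = closedLoopIter f ε x₀ k m := by
  induction k', hk using Nat.le_induction with
  | base => rfl
  | succ k' hk ih =>
    rw [closedLoopIter, Function.update_of_ne (by omega), ih]

theorem exists_isClosedLoop (f : ℝ → ℝ) {K : ℕ} (ε : Fin K → ℝ) (x₀ : ℕ → ℝ) :
    ∃ x : ℕ → ℝ, IsClosedLoop f ε x ∧ ∀ i ≤ 2 * K, x i = x₀ i := by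
  set z := closedLoopIter f ε x₀ with hz
  have hdiag : ∀ m k, m ≤ 2 * K + k → z m m = z k m := by
    intro m k hm
    rw [hz, ← closedLoopIter_eq_of_le f ε x₀ (le_add_left le_rfl) (le_max_left m k),
      closedLoopIter_eq_of_le f ε x₀ hm (le_max_right m k)]
  refine ⟨fun m => z m m, fun n hn => ?_, fun i hi => ?_⟩
  · obtain ⟨k, rfl⟩ := Nat.exists_eq_add_of_le hn
    have h1 := hdiag (2 * K + k + 1) (k + 1) (by omega)
    have h2 : feedbackControl f ε (fun m => z m m) (2 * K + k) =
        feedbackControl f ε (z k) (2 * K + k) :=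
      feedbackControl_congr fun m hm => hdiag m k hm
    simp only [h1, h2, hdiag (2 * K + k) k le_rfl]
    rw [hz, closedLoopIter, Function.update_self]
  · exact hdiag i 0 (by omega)

/-- With `z = l ^ n`, `2 (Re z)² - Re (z²) = ‖z‖² ≥ 1`, whereas the left side would tend to 0. -/
theorem not_tendsto_re_pow {l : ℂ} (hl : 1 ≤ ‖l‖) :
    ¬ Tendsto (fun n : ℕ => (l ^ n).re) atTop (𝓝 0) := by
  intro h
  have h2 : Tendsto (fun n : ℕ => (l ^ (2 * n)).re) atTop (𝓝 0) :=
    h.comp (tendsto_id.const_mul_atTop' two_pos)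
  have h3 : Tendsto (fun n : ℕ => 2 * (l ^ n).re ^ 2 - (l ^ (2 * n)).re) atTop (𝓝 0) := by
    simpa using ((h.pow 2).const_mul 2).sub h2
  have h4 : ∀ n : ℕ, 1 ≤ 2 * (l ^ n).re ^ 2 - (l ^ (2 * n)).re := by
    intro n
    have h5 : (l ^ (2 * n)).re = (l ^ n).re ^ 2 - (l ^ n).im ^ 2 := by
      rw [mul_comm, pow_mul, sq, Complex.mul_re]; ring
    have h6 : (1 : ℝ) ≤ ‖l ^ n‖ ^ 2 := by
      rw [norm_pow]; exact one_le_pow₀ (one_le_pow₀ hl)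
    rw [Complex.sq_norm, Complex.normSq_apply] at h6
    rw [h5]; nlinarith
  have := ge_of_tendsto' h3 h4
  norm_num at this

/-- A smooth bounded map which is affine near `1` and `-1` and has the cycle `(1, -1)` with
multiplier `μ`. -/
theorem exists_locally_affine_map (μ : ℝ) : ∃ f : ℝ → ℝ, ∃ R : ℝ, 2 ≤ R ∧ Differentiable ℝ f ∧
    (∀ x, f x ∈ Set.Icc (-R) R) ∧ (∀ y, |y| < 1 / 3 → f (1 + y) = -1 + y) ∧
    (∀ y, |y| < 1 / 3 → f (-1 + y) = 1 + μ * y) := by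
  let φ₁ : ContDiffBump (1 : ℝ) := ⟨1 / 3, 2 / 3, by norm_num, by norm_num⟩
  let φ₂ : ContDiffBump (-1 : ℝ) := ⟨1 / 3, 2 / 3, by norm_num, by norm_num⟩
  refine ⟨fun x => φ₁ x * (-1 + (x - 1)) + φ₂ x * (1 + μ * (x + 1)), 3 + |μ|, ?_, ?_, ?_, ?_, ?_⟩
  · linarith [abs_nonneg μ]
  · have h1 : Differentiable ℝ φ₁ := (φ₁.contDiff (n := 1)).differentiable (by norm_num)
    have h2 : Differentiable ℝ φ₂ := (φ₂.contDiff (n := 1)).differentiable (by norm_num)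
    fun_prop
  · intro x
    rw [Set.mem_Icc, ← abs_le]
    have h1 : |φ₁ x * (-1 + (x - 1))| ≤ 5 / 3 := by
      by_cases hx : |x - 1| < 2 / 3
      · rw [abs_mul, abs_of_nonneg φ₁.nonneg]
        have h3 : |-1 + (x - 1)| ≤ 5 / 3 := by
          rw [abs_lt] at hx; rw [abs_le]; constructor <;> linarith
        calc _ ≤ 1 * (5 / 3) := mul_le_mul φ₁.le_one h3 (abs_nonneg _) zero_le_one
          _ = _ := one_mul _
      · have : φ₁ x = 0 := φ₁.zero_of_le_dist (by rw [Real.dist_eq]; exact not_lt.1 hx)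
        rw [this]; norm_num
    have h2 : |φ₂ x * (1 + μ * (x + 1))| ≤ 1 + |μ| := by
      by_cases hx : |x + 1| < 2 / 3
      · rw [abs_mul, abs_of_nonneg φ₂.nonneg]
        have h3 : |1 + μ * (x + 1)| ≤ 1 + |μ| := by
          refine (abs_add_le _ _).trans ?_
          rw [abs_mul, abs_one]
          nlinarith [abs_nonneg μ]
        calc _ ≤ 1 * (1 + |μ|) := mul_le_mul φ₂.le_one h3 (abs_nonneg _) zero_le_one
          _ = _ := one_mul _
      · have : φ₂ x = 0 := φ₂.zero_of_le_dist (by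
          rw [Real.dist_eq, sub_neg_eq_add]; exact not_lt.1 hx)
        rw [this]; simp; positivity
    exact (abs_add_le _ _).trans (by linarith)
  · intro y hy
    have h1 : φ₁ (1 + y) = 1 := φ₁.one_of_mem_closedBall (by
      rw [Metric.mem_closedBall, Real.dist_eq, add_sub_cancel_left]; exact hy.le)
    have h2 : φ₂ (1 + y) = 0 := φ₂.zero_of_le_dist (by
      rw [Real.dist_eq]; rw [abs_lt] at hy
      exact le_trans (by change (2 / 3 : ℝ) ≤ 1 + y - -1; linarith) (le_abs_self _))
    simp only [h1, h2]; ring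
  · intro y hy
    have h1 : φ₁ (-1 + y) = 0 := φ₁.zero_of_le_dist (by
      rw [Real.dist_eq]; rw [abs_lt] at hy
      exact le_trans (by change (2 / 3 : ℝ) ≤ -(-1 + y - 1); linarith) (neg_le_abs _))
    have h2 : φ₂ (-1 + y) = 1 := φ₂.one_of_mem_closedBall (by
      rw [Metric.mem_closedBall, Real.dist_eq, add_sub_cancel_left]; exact hy.le)
    simp only [h1, h2]; ring

/-- A real solution, which does not tend to zero, of the closed loop linearized at the cycle
with slopes `1` and `μ`. -/
theorem exists_linear_solution {K : ℕ} {ε : Fin K → ℝ} {w : ℂ} (hw : ‖w‖ ≤ 1) {μ : ℝ}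
    (h : (μ : ℂ) * transfer ε w ^ 2 = 1) : ∃ y : ℕ → ℝ, ¬ Tendsto y atTop (𝓝 0) ∧
      ∀ n, 2 * K ≤ n → y (n + 1) = (if Even n then 1 else μ) *
        ∑ j ∈ Finset.range (K + 1), weight ε j * y (n - 2 * j) := by
  have hP : transfer ε w ≠ 0 := by
    intro h0; rw [h0] at h; norm_num at h
  have hw0 : w ≠ 0 := by
    rintro rfl; exact hP (by simp [transfer])
  set P := transfer ε w with hPdef
  set l := w⁻¹ with hl
  have hl0 : l ≠ 0 := inv_ne_zero hw0
  have hl1 : 1 ≤ ‖l‖ := by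
    rw [hl, norm_inv]; exact (one_le_inv₀ (norm_pos_iff.2 hw0)).2 hw
  -- Geometric growth with amplitude `P` at odd times: steps from even times hold by the definition
  -- of `P`, steps from odd times because `μ P² = 1`.
  set Y : ℕ → ℂ := fun n => l ^ n * (if Even n then 1 else P) with hY
  refine ⟨fun n => (Y n).re, fun ht => ?_, fun n hn => ?_⟩
  · refine not_tendsto_re_pow (l := l ^ 2) (by rw [norm_pow]; exact one_le_pow₀ hl1) ?_
    have h1 : Tendsto (fun n : ℕ => (Y (2 * n)).re) atTop (𝓝 0) :=
      ht.comp (tendsto_id.const_mul_atTop' two_pos)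
    simpa [hY, pow_mul] using h1
  · have hsum : ∑ j ∈ Finset.range (K + 1), (weight ε j : ℂ) * l ^ (n - 2 * j) =
        l ^ (n + 1) * P := by
      rw [hPdef, transfer_eq_sum_weight, Finset.mul_sum]
      refine Finset.sum_congr rfl fun j hj => ?_
      have hj' : j < K + 1 := Finset.mem_range.1 hj
      have : l ^ (n + 1) = l ^ (n - 2 * j) * l ^ (2 * j + 1) := by
        rw [← pow_add]; congr 1; omega
      rw [this, hl, inv_pow _ (2 * j + 1)]
      field_simp
    have hC : Y (n + 1) = ((if Even n then 1 else μ : ℝ) : ℂ) *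
        ∑ j ∈ Finset.range (K + 1), (weight ε j : ℂ) * Y (n - 2 * j) := by
      have h2 : ∑ j ∈ Finset.range (K + 1), (weight ε j : ℂ) * Y (n - 2 * j) =
          l ^ (n + 1) * P * (if Even n then 1 else P) := by
        rw [← hsum, Finset.sum_mul]
        refine Finset.sum_congr rfl fun j hj => ?_
        have hj' : j < K + 1 := Finset.mem_range.1 hj
        have : Even (n - 2 * j) ↔ Even n := by rw [Nat.even_sub (by omega)]; simp
        simp only [hY, this]; ring
      rw [h2]
      by_cases he : Even n
      · simp [hY, he, Nat.even_add_one]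
      · simp only [hY, he, Nat.even_add_one, if_false, not_false_eq_true, if_true]
        linear_combination (-l ^ (n + 1)) * h
    have := congrArg Complex.re hC
    rw [Complex.re_ofReal_mul, Complex.re_sum] at this
    simpa only [Complex.re_ofReal_mul] using this

/-- Lyapunov stability confines a trajectory to the region where the test map is affine; there it is
exactly a multiple of the non-decaying linear solution, against attractivity. -/
theorem transferAvoids_of_stabilizesAllCycles {μs : ℝ} {K : ℕ} {ε : Fin K → ℝ}
    (hst : StabilizesAllCycles μs ε) : TransferAvoids ε μs := by
  intro w hw μ hμ h
  obtain ⟨y, hy, hlin⟩ := exists_linear_solution hw h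
  obtain ⟨f, R, hR, hd, hbd, h₁, h₂⟩ := exists_locally_affine_map μ
  have hev₁ : HasDerivAt f 1 1 := by
    have h0 : HasDerivAt (fun x : ℝ => -1 + (x - 1)) 1 1 :=
      ((hasDerivAt_id (1 : ℝ)).sub_const 1).const_add (-1)
    refine h0.congr_of_eventuallyEq ?_
    filter_upwards [Metric.ball_mem_nhds (1 : ℝ) (by norm_num : (0 : ℝ) < 1 / 3)] with x hx
    rw [Metric.mem_ball, Real.dist_eq] at hx
    rw [← h₁ _ hx]; congr 1; ring
  have hev₂ : HasDerivAt f μ (-1) := by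
    have h0 : HasDerivAt (fun x : ℝ => 1 + μ * (x + 1)) μ (-1) := by
      simpa using (((hasDerivAt_id (-1 : ℝ)).add_const 1).const_mul μ).const_add 1
    refine h0.congr_of_eventuallyEq ?_
    filter_upwards [Metric.ball_mem_nhds (-1 : ℝ) (by norm_num : (0 : ℝ) < 1 / 3)] with x hx
    rw [Metric.mem_ball, Real.dist_eq, sub_neg_eq_add] at hx
    rw [← h₂ _ hx]; congr 1; ring
  have hnhds₁ : Set.Icc (-R) R ∈ 𝓝 (1 : ℝ) := Icc_mem_nhds (by linarith) (by linarith)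
  have hnhds₂ : Set.Icc (-R) R ∈ 𝓝 (-1 : ℝ) := Icc_mem_nhds (by linarith) (by linarith)
  have hcyc : IsTwoCycle f (Set.Icc (-R) R) 1 (-1) :=
    { mem₁ := mem_of_mem_nhds hnhds₁
      mem₂ := mem_of_mem_nhds hnhds₂
      ne := by norm_num
      map₁ := by simpa using h₁ 0 (by norm_num)
      map₂ := by simpa using h₂ 0 (by norm_num) }
  obtain ⟨hlya, δ₂, hδ₂, hattr⟩ := hst (Set.Icc (-R) R) f 1 (-1) Set.ordConnected_Icc
    (Metric.isBounded_Icc _ _) (fun x _ => hbd x) hd.differentiableOn hcyc (by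
      rw [derivWithin_of_mem_nhds hnhds₁, derivWithin_of_mem_nhds hnhds₂, hev₁.deriv, hev₂.deriv,
        one_mul]
      exact hμ)
  obtain ⟨δ₁, hδ₁, hstab⟩ := hlya (1 / 3) (by norm_num)
  set A := ∑ i ∈ Finset.range (2 * K + 1), |y i| with hA
  have hA0 : 0 ≤ A := Finset.sum_nonneg fun _ _ => abs_nonneg _
  set δ := min (min δ₁ δ₂) 1 with hδ
  have hδ0 : 0 < δ := by positivity
  set s := δ / (A + 1) with hs
  have hs0 : 0 < s := by positivity
  have hsy : ∀ i ≤ 2 * K, |s * y i| < δ := by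
    intro i hi
    have h1 : |y i| ≤ A := Finset.single_le_sum (f := fun i => |y i|)
      (fun _ _ => abs_nonneg _) (Finset.mem_range.2 (by omega))
    rw [abs_mul, abs_of_pos hs0, hs, div_mul_eq_mul_div, div_lt_iff₀ (by positivity)]
    nlinarith
  obtain ⟨x, hx, hxi⟩ := exists_isClosedLoop f ε (fun n => cycleSeq 1 (-1) n + s * y n)
  have hcy1 : ∀ n, |cycleSeq 1 (-1) n| ≤ 1 := by
    intro n; by_cases hn : Even n <;> simp [cycleSeq, hn]
  have hinit : ∀ i ≤ 2 * K, x i ∈ Set.Icc (-R) R ∧ |x i - cycleSeq 1 (-1) i| < δ := by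
    intro i hi
    rw [hxi i hi, add_sub_cancel_left]
    refine ⟨?_, hsy i hi⟩
    rw [Set.mem_Icc, ← abs_le]
    have := (hsy i hi).trans_le (min_le_right _ _)
    exact (abs_add_le _ _).trans (by linarith [hcy1 i])
  have hclose : ∀ n, |x n - cycleSeq 1 (-1) n| < 1 / 3 := fun n =>
    (hstab x hx (fun i hi => ⟨(hinit i hi).1, (hinit i hi).2.trans_le
      ((min_le_left _ _).trans (min_le_left _ _))⟩) n).2
  have hf : ∀ n, f (x n) = cycleSeq 1 (-1) (n + 1) +
      (if Even n then 1 else μ) * (x n - cycleSeq 1 (-1) n) := by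
    intro n
    have h3 := hclose n
    by_cases hn : Even n
    · simp only [cycleSeq, hn, if_true, Nat.even_add_one, not_true_eq_false, if_false] at h3 ⊢
      rw [one_mul, ← h₁ _ h3]; congr 1; ring
    · simp only [cycleSeq, hn, if_false, Nat.even_add_one, not_false_eq_true, if_true] at h3 ⊢
      rw [← h₂ _ h3]; congr 1; ring
  have hsol : ∀ n, x n = cycleSeq 1 (-1) n + s * y n := by
    intro n
    induction n using Nat.strong_induction_on with
    | _ n ih =>
      by_cases hn : n ≤ 2 * K
      · exact hxi n hn
      · obtain ⟨m, rfl⟩ : ∃ m, n = m + 1 := ⟨n - 1, by omega⟩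
        have hm : 2 * K ≤ m := by omega
        rw [closedLoop_eq_sum_weight hx hm, hlin m hm]
        have h4 : ∀ j ∈ Finset.range (K + 1), weight ε j * f (x (m - 2 * j)) =
            weight ε j * cycleSeq 1 (-1) (m + 1) +
              s * ((if Even m then 1 else μ) * (weight ε j * y (m - 2 * j))) := by
          intro j hj
          have hj' : j < K + 1 := Finset.mem_range.1 hj
          have hpar : Even (m - 2 * j) ↔ Even m := by rw [Nat.even_sub (by omega)]; simp
          have h5 : cycleSeq 1 (-1) (m - 2 * j + 1) = cycleSeq 1 (-1) (m + 1) := by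
            simp [cycleSeq, Nat.even_add_one, hpar]
          rw [hf, ih (m - 2 * j) (by omega), h5]
          simp only [hpar]
          ring
        rw [Finset.sum_congr rfl h4, Finset.sum_add_distrib, ← Finset.sum_mul, sum_weight,
          one_mul, ← Finset.mul_sum, ← Finset.mul_sum]
  have hlim := hattr x hx (fun i hi => ⟨(hinit i hi).1, (hinit i hi).2.trans_le
      ((min_le_left _ _).trans (min_le_right _ _))⟩)
  refine hy ?_
  have h6 : Tendsto (fun n => s⁻¹ * (x n - cycleSeq 1 (-1) n)) atTop (𝓝 0) := by
    simpa using hlim.const_mul s⁻¹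
  refine h6.congr fun n => ?_
  rw [hsol n]
  field_simp
  ring

end

/-! ### Fejér gains -/

theorem transfer_neg {K : ℕ} (ε : Fin K → ℝ) (w : ℂ) : transfer ε (-w) = -transfer ε w := by
  simp only [transfer, neg_add, ← Finset.sum_neg_distrib]
  congr 1
  refine Finset.sum_congr rfl fun j _ => ?_
  rw [Odd.neg_pow ⟨(j : ℕ) + 1, by ring⟩, Odd.neg_pow ⟨(j : ℕ), by ring⟩]
  ring

/-- From `μ P² = 1` and `μ < 0`, `P` is imaginary; `hpos` and oddness make `w` imaginary, and there
`him` gives `P.im² ≤ 1 / μs`. The non-strict bound suffices because the multiplier interval is open.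
-/
theorem transferAvoids_of_re_pos {K : ℕ} {ε : Fin K → ℝ} {μs : ℝ} (hμs : 0 < μs)
    (hpos : ∀ w : ℂ, ‖w‖ ≤ 1 → 0 < w.re → 0 < (transfer ε w).re)
    (him : ∀ r : ℝ, |r| ≤ 1 → ‖transfer ε (r * Complex.I)‖ ≤ 1 / √μs) :
    TransferAvoids ε μs := by
  intro w hw μ hμ h
  set P := transfer ε w with hP
  have hre : μ * (P.re ^ 2 - P.im ^ 2) = 1 := by
    have := congrArg Complex.re h
    rw [Complex.re_ofReal_mul, sq, Complex.mul_re, Complex.one_re] at this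
    rw [← this]; ring
  have him2 : P.re * P.im = 0 := by
    have := congrArg Complex.im h
    rw [Complex.im_ofReal_mul, sq, Complex.mul_im, Complex.one_im] at this
    have hμ0 : μ ≠ 0 := by linarith [hμ.2]
    have h2 := (mul_eq_zero.1 this).resolve_left hμ0
    linarith
  have hre0 : P.re = 0 := by
    rcases mul_eq_zero.1 him2 with h0 | h0
    · exact h0
    · rw [h0] at hre; nlinarith [hμ.2, sq_nonneg P.re]
  rcases lt_trichotomy w.re 0 with hw0 | hw0 | hw0
  · have := hpos (-w) (by rwa [norm_neg]) (by simpa using hw0)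
    rw [transfer_neg, Complex.neg_re, ← hP, hre0] at this
    simp at this
  · have hwI : w = w.im * Complex.I := by
      apply Complex.ext <;> simp [hw0]
    have h1 := him w.im ((Complex.abs_im_le_norm w).trans hw)
    rw [← hwI, ← hP] at h1
    have h2 : ‖P‖ ^ 2 = P.im ^ 2 := by
      rw [Complex.sq_norm, Complex.normSq_apply, hre0]; ring
    have h3 : ‖P‖ ^ 2 ≤ 1 / μs := by
      calc ‖P‖ ^ 2 ≤ (1 / √μs) ^ 2 := by gcongr
        _ = 1 / μs := by rw [div_pow, one_pow, Real.sq_sqrt hμs.le]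
    rw [h2, le_div_iff₀ hμs] at h3
    rw [hre0] at hre
    have h4 : P.im ^ 2 * (-μ) = 1 := by linarith
    have h5 : 0 < P.im ^ 2 := by
      by_contra h6
      have : P.im ^ 2 = 0 := le_antisymm (not_lt.1 h6) (sq_nonneg _)
      rw [this] at h4; norm_num at h4
    nlinarith [hμ.1]
  · have := hpos w hw hw0
    rw [← hP, hre0] at this
    exact lt_irrefl _ this

/-- The polynomial `∑ j < N, (2N - 2j - 1) w ^ (2j+1)`. -/
noncomputable def fejerSum (N : ℕ) (w : ℂ) : ℂ :=
  ∑ j ∈ Finset.range N, (2 * N - 2 * j - 1 : ℂ) * w ^ (2 * j + 1)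

/-- Stated over any commutative ring because it serves over `ℂ` with `z = w ^ 2` and over `ℝ` with
`z = -r ^ 2`. -/
theorem one_sub_sq_mul_fejer_sum {R : Type*} [CommRing R] (N : ℕ) (z : R) :
    (1 - z) ^ 2 * ∑ j ∈ Finset.range N, (2 * N - 2 * j - 1 : R) * z ^ j =
      (2 * N - 1) - (2 * N + 1) * z + z ^ N * (1 + z) := by
  induction N with
  | zero => simp
  | succ N ih =>
    have h1 : ∑ j ∈ Finset.range (N + 1), (2 * (N + 1 : ℕ) - 2 * j - 1 : R) * z ^ j =
        ∑ j ∈ Finset.range N, (2 * N - 2 * j - 1 : R) * z ^ j +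
          2 * ∑ j ∈ Finset.range N, z ^ j + z ^ N := by
      rw [Finset.sum_range_succ, Finset.mul_sum, ← Finset.sum_add_distrib]
      congr 1
      · refine Finset.sum_congr rfl fun j _ => ?_
        push_cast; ring
      · push_cast; ring
    have h2 : (∑ j ∈ Finset.range N, z ^ j) * (1 - z) = 1 - z ^ N := geom_sum_mul_neg z N
    rw [h1, mul_add, mul_add, ih]
    push_cast
    linear_combination (2 * (1 - z)) * h2

theorem one_sub_sq_mul_fejerSum (N : ℕ) (w : ℂ) :
    (1 - w ^ 2) ^ 2 * fejerSum N w =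
      w * ((2 * N - 1) - (2 * N + 1) * w ^ 2 + (w ^ 2) ^ N * (1 + w ^ 2)) := by
  rw [← one_sub_sq_mul_fejer_sum, fejerSum, mul_left_comm, Finset.mul_sum (a := w)]
  congr 1
  refine Finset.sum_congr rfl fun j _ => ?_
  rw [← pow_mul]; ring

/-- For `w = exp (i t)` with `sin t ≠ 0` the real part is `cos t * (sin (N t) / sin t) ^ 2`; the
remaining point `w = 1` is read off from the coefficients. -/
theorem fejerSum_re_nonneg_of_norm_eq_one (N : ℕ) {w : ℂ} (hw : ‖w‖ = 1) (hre : 0 ≤ w.re) :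
    0 ≤ (fejerSum N w).re := by
  have hconj : w * (starRingEnd ℂ) w = 1 := by
    rw [Complex.mul_conj, Complex.normSq_eq_norm_sq, hw]; norm_num
  set v := (starRingEnd ℂ) w with hv
  have hsub : v - w = -(2 * w.im : ℝ) * Complex.I := by
    apply Complex.ext <;> simp [hv]; ring
  have hadd : v + w = (2 * w.re : ℝ) := by
    apply Complex.ext <;> simp [hv]; ring
  have hsq : (v - w) ^ 2 = ((-4 * w.im ^ 2 : ℝ) : ℂ) := by
    rw [hsub, mul_pow, Complex.I_sq]; push_cast; ring
  have h1 : (v - w) ^ 2 * fejerSum N w =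
      (2 * N - 1) * v - (2 * N + 1) * w + (w ^ 2) ^ N * (v + w) := by
    have h2 := one_sub_sq_mul_fejerSum N w
    have h3 : v - w = v * (1 - w ^ 2) := by linear_combination w * hconj
    rw [h3, mul_pow, mul_assoc, h2]
    linear_combination (v * ((2 * N - 1) + (w ^ 2) ^ N) +
      w * ((-1) * (2 * N + 1) + (w ^ 2) ^ N) * (1 + v * w)) * hconj
  have h4 := congrArg Complex.re h1
  rw [hsq, hadd, Complex.re_ofReal_mul] at h4
  have hwN : ‖(w ^ 2) ^ N‖ = 1 := by rw [norm_pow, norm_pow, hw]; simp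
  have hReN : ((w ^ 2) ^ N).re ≤ 1 := hwN ▸ Complex.re_le_norm _
  have h5 : -4 * w.im ^ 2 * (fejerSum N w).re = -2 * w.re * (1 - ((w ^ 2) ^ N).re) := by
    rw [h4, Complex.add_re, Complex.sub_re, Complex.re_mul_ofReal]
    have e1 : ((2 * (N : ℂ) - 1) * v).re = (2 * N - 1) * w.re := by
      have : (2 * (N : ℂ) - 1) = ((2 * N - 1 : ℝ) : ℂ) := by push_cast; rfl
      rw [this, Complex.re_ofReal_mul, hv, Complex.conj_re]
    have e2 : ((2 * (N : ℂ) + 1) * w).re = (2 * N + 1) * w.re := by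
      have : (2 * (N : ℂ) + 1) = ((2 * N + 1 : ℝ) : ℂ) := by push_cast; rfl
      rw [this, Complex.re_ofReal_mul]
    rw [e1, e2]; ring
  by_cases him : w.im = 0
  · have hw1 : w = 1 := by
      have : w.re ^ 2 = 1 := by
        have := Complex.sq_norm w
        rw [hw, Complex.normSq_apply, him] at this
        linarith
      have hre1 : w.re = 1 := by nlinarith
      exact Complex.ext hre1 him
    rw [hw1, fejerSum, Complex.re_sum]
    refine Finset.sum_nonneg fun j hj => ?_
    have hj' : j + 1 ≤ N := Finset.mem_range.1 hj
    have hj2 : (j : ℝ) + 1 ≤ N := by exact_mod_cast hj'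
    simp
    linarith
  · have : 0 < w.im ^ 2 := by positivity
    by_contra hneg
    nlinarith

theorem differentiable_fejerSum (N : ℕ) : Differentiable ℂ (fejerSum N) := by
  unfold fejerSum; fun_prop

theorem fejerSum_mul_I_eq (N : ℕ) (r : ℝ) : fejerSum N (r * Complex.I) =
    ((∑ j ∈ Finset.range N, (2 * N - 2 * j - 1 : ℝ) * (-r ^ 2) ^ j) * r : ℝ) * Complex.I := by
  rw [fejerSum]
  push_cast
  rw [Finset.sum_mul, Finset.sum_mul]
  refine Finset.sum_congr rfl fun j _ => ?_
  rw [pow_succ, pow_mul, mul_pow, Complex.I_sq]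
  ring

/-- Maximum principle for `exp (-fejerSum N z)` on the right half-disc: its modulus is at most 1 on
the arc, and equals 1 on the diameter, where the sum is purely imaginary. -/
theorem fejerSum_re_nonneg (N : ℕ) {w : ℂ} (hw : ‖w‖ ≤ 1) (hre : 0 < w.re) :
    0 ≤ (fejerSum N w).re := by
  set U : Set ℂ := Metric.ball 0 1 ∩ {z : ℂ | 0 < z.re} with hU
  have hbd : Bornology.IsBounded U := Metric.isBounded_ball.subset Set.inter_subset_left
  have hdiff : Differentiable ℂ fun z => Complex.exp (-fejerSum N z) :=
    (differentiable_fejerSum N).neg.cexp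
  have hfr : ∀ z ∈ frontier U, ‖Complex.exp (-fejerSum N z)‖ ≤ 1 := by
    intro z hz
    rw [Complex.norm_exp, Complex.neg_re, Real.exp_le_one_iff, neg_nonpos]
    have hz' := frontier_inter_subset _ _ hz
    rw [Complex.frontier_setOfPred_lt_re, Complex.closure_setOfPred_lt_re, frontier_ball _ one_ne_zero]
      at hz'
    rcases hz' with ⟨h1, h2⟩ | ⟨_, h2⟩
    · exact fejerSum_re_nonneg_of_norm_eq_one N (by simpa using h1) h2
    · have hzI : z = z.im * Complex.I := by
        apply Complex.ext <;> simp
        exact h2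
      rw [hzI, fejerSum_mul_I_eq, Complex.re_ofReal_mul]
      simp
  have hcl : w ∈ closure U := by
    have hmem : ∀ t ∈ Set.Ioo (0 : ℝ) 1, (t : ℂ) * w ∈ U := by
      intro t ht
      refine ⟨?_, ?_⟩
      · rw [mem_ball_zero_iff, norm_mul, Complex.norm_real, Real.norm_eq_abs, abs_of_pos ht.1]
        nlinarith [ht.1, ht.2, norm_nonneg w]
      · change 0 < ((t : ℂ) * w).re
        rw [Complex.re_ofReal_mul]; exact mul_pos ht.1 hre
    have hlim : Filter.Tendsto (fun t : ℝ => (t : ℂ) * w) (nhdsWithin 1 (Set.Iio 1))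
        (nhds w) := by
      have : ContinuousAt (fun t : ℝ => (t : ℂ) * w) 1 := by fun_prop
      have h2 := this.tendsto
      simp only [Complex.ofReal_one, one_mul] at h2
      exact h2.mono_left nhdsWithin_le_nhds
    refine mem_closure_of_tendsto hlim ?_
    filter_upwards [Ioo_mem_nhdsLT (zero_lt_one' ℝ)] with t ht using hmem t ht
  have := Complex.norm_le_of_forall_mem_frontier_norm_le hbd hdiff.diffContOnCl hfr hcl
  rwa [Complex.norm_exp, Complex.neg_re, Real.exp_le_one_iff, neg_nonpos] at this

/-- With `ρ = |r|` and `q = ρ²`, the closed form exhibits `(1 + q)² (N - Tρ)` as a sum of two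
visibly nonnegative terms. -/
theorem abs_fejer_alternating_sum_le (N : ℕ) {r : ℝ} (hr : |r| ≤ 1) :
    |(∑ j ∈ Finset.range N, (2 * N - 2 * j - 1 : ℝ) * (-r ^ 2) ^ j) * r| ≤ N := by
  set T := ∑ j ∈ Finset.range N, (2 * N - 2 * j - 1 : ℝ) * (-r ^ 2) ^ j with hT
  have h := one_sub_sq_mul_fejer_sum N (-r ^ 2)
  rw [← hT] at h
  rw [abs_mul]
  set ρ := |r| with hρ
  have hρ0 : 0 ≤ ρ := abs_nonneg r
  have hsq : r ^ 2 = ρ ^ 2 := (sq_abs r).symm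
  rw [hsq] at h
  set q := ρ ^ 2 with hq
  have hq0 : 0 ≤ q := sq_nonneg _
  have hq1 : q ≤ 1 := pow_le_one₀ hρ0 hr
  have hE : |(-q) ^ N| ≤ 1 := by
    rw [abs_pow, abs_neg, abs_of_nonneg hq0]; exact pow_le_one₀ hq0 hq1
  rw [abs_le] at hE
  rcases Nat.eq_zero_or_pos N with rfl | hN
  · simp [hT]
  have hN1 : (1 : ℝ) ≤ N := by exact_mod_cast hN
  have hpos : 0 < (1 + q) ^ 2 := by positivity
  have hT0 : 0 ≤ T := by
    have : 0 ≤ (1 + q) ^ 2 * T := by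
      have h' : (1 + q) ^ 2 * T = (2 * N - 1) + (2 * N + 1) * q + (-q) ^ N * (1 - q) := by
        linear_combination h
      rw [h']; nlinarith
    exact nonneg_of_mul_nonneg_right this hpos
  rw [abs_of_nonneg hT0]
  have h2 : (1 + q) ^ 2 * (T * ρ) ≤ (1 + q) ^ 2 * N := by
    have h' : (1 + q) ^ 2 * (N - T * ρ) =
        N * (1 + q) * (1 - ρ) ^ 2 + ρ * (1 - q) * (1 - (-q) ^ N) := by
      rw [hq] at h ⊢; linear_combination (-ρ) * h
    have h3 : 0 ≤ N * (1 + q) * (1 - ρ) ^ 2 := by positivity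
    have h4 : 0 ≤ ρ * (1 - q) * (1 - (-q) ^ N) :=
      mul_nonneg (mul_nonneg hρ0 (by linarith)) (by linarith)
    linarith
  exact le_of_mul_le_mul_left h2 hpos

/-- Fejér's gains `(1 - η) ((K - j) / (K + 1))²`. -/
noncomputable def fejerGain (K : ℕ) (η : ℝ) (j : Fin K) : ℝ :=
  (1 - η) * ((K - (j : ℕ)) / (K + 1)) ^ 2

theorem gainSeq_fejerGain (K : ℕ) (η : ℝ) {j : ℕ} (hj : j ≤ K) :
    gainSeq (fejerGain K η) (j + 1) = (1 - η) * ((K - j) / (K + 1)) ^ 2 := by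
  rcases hj.lt_or_eq with h | rfl
  · simp [gainSeq, h, fejerGain]
  · simp [gainSeq]

theorem weight_fejerGain_nonneg (K : ℕ) {η : ℝ} (h0 : 0 ≤ η) (h1 : η ≤ 1) {j : ℕ} (hj : j ≤ K) :
    0 ≤ weight (fejerGain K η) j := by
  rw [weight, gainSeq_fejerGain K η hj, sub_nonneg]
  have hjK : (j : ℝ) ≤ K := by exact_mod_cast hj
  rcases j with _ | j
  · simp only [gainSeq, Nat.cast_zero, sub_zero]
    have h2 : ((K : ℝ) / (K + 1)) ^ 2 ≤ 1 := by
      refine pow_le_one₀ (by positivity) ?_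
      rw [div_le_one (by positivity)]; linarith
    nlinarith [sq_nonneg ((K : ℝ) / (K + 1))]
  · rw [gainSeq_fejerGain K η (by omega)]
    push_cast at hjK ⊢
    have : (0 : ℝ) ≤ K - (j + 1) := by linarith
    gcongr
    · linarith

theorem abs_fejerGain_lt_one (K : ℕ) {η : ℝ} (h0 : 0 ≤ η) (h1 : η ≤ 1) (j : Fin K) :
    |fejerGain K η j| < 1 := by
  have hj : (j : ℝ) < K := by exact_mod_cast j.2
  have hj0 : (0 : ℝ) ≤ (j : ℕ) := Nat.cast_nonneg _
  have h2 : (0 : ℝ) ≤ (K - (j : ℕ)) / (K + 1) := div_nonneg (by linarith) (by positivity)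
  have h3 : ((K : ℝ) - (j : ℕ)) / (K + 1) < 1 := by
    rw [div_lt_one (by positivity)]; linarith
  have h4 : (((K : ℝ) - (j : ℕ)) / (K + 1)) ^ 2 < 1 := pow_lt_one₀ h2 h3 two_ne_zero
  rw [fejerGain, abs_of_nonneg (mul_nonneg (by linarith) (sq_nonneg _))]
  nlinarith [sq_nonneg (((K : ℝ) - (j : ℕ)) / (K + 1))]

theorem transfer_fejerGain (K : ℕ) (η : ℝ) (w : ℂ) : transfer (fejerGain K η) w =
    ((1 - η : ℝ) : ℂ) * (((1 / (K + 1) ^ 2 : ℝ) : ℂ) * fejerSum (K + 1) w) + (η : ℂ) * w := by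
  have h0 : transfer (fejerGain K η) w =
      ((1 - η : ℝ) : ℂ) * transfer (fejerGain K 0) w + (η : ℂ) * w := by
    have h1 : ∀ j, (fejerGain K η j : ℂ) = ((1 - η : ℝ) : ℂ) * (fejerGain K 0 j : ℂ) := by
      intro j; simp only [fejerGain]; push_cast; ring
    simp only [transfer, h1, mul_add, Finset.mul_sum, mul_assoc]
    push_cast; ring
  rw [h0, transfer_eq_sum_weight, fejerSum, Finset.mul_sum (a := ((1 / (K + 1) ^ 2 : ℝ) : ℂ))]
  congr 2
  refine Finset.sum_congr rfl fun j hj => ?_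
  have hj' : j ≤ K := Nat.lt_succ_iff.1 (Finset.mem_range.1 hj)
  have hK : ((K : ℝ) + 1) ≠ 0 := by positivity
  have hwt : weight (fejerGain K 0) j = 1 / (K + 1) ^ 2 * (2 * (K + 1 : ℕ) - 2 * j - 1) := by
    rw [weight, gainSeq_fejerGain K 0 hj']
    rcases j with _ | j
    · simp only [gainSeq]; push_cast; field_simp; ring
    · rw [gainSeq_fejerGain K 0 (by omega)]; push_cast; field_simp; ring
  rw [hwt]; push_cast; ring

theorem transferAvoids_fejerGain {K : ℕ} {η μs : ℝ} (hη0 : 0 ≤ η) (hη1 : η ≤ 1) (hμs : 0 < μs)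
    (hpos : ∀ w : ℂ, ‖w‖ ≤ 1 → 0 < w.re → 0 < (transfer (fejerGain K η) w).re)
    (hη : (1 - η) / (K + 1) + η ≤ 1 / √μs) : TransferAvoids (fejerGain K η) μs := by
  refine transferAvoids_of_re_pos hμs hpos fun r hr => le_trans ?_ hη
  rw [transfer_fejerGain, fejerSum_mul_I_eq]
  set T := (∑ j ∈ Finset.range (K + 1), (2 * (K + 1 : ℕ) - 2 * j - 1 : ℝ) * (-r ^ 2) ^ j) * r
    with hT
  have hTle : |T| ≤ (K + 1 : ℕ) := abs_fejer_alternating_sum_le (K + 1) hr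
  push_cast at hTle
  refine (norm_add_le _ _).trans ?_
  simp only [norm_mul, Complex.norm_real, Complex.norm_I, mul_one, Real.norm_eq_abs]
  rw [abs_of_nonneg hη0, abs_of_nonneg (by linarith : 0 ≤ 1 - η),
    abs_of_pos (by positivity : (0 : ℝ) < 1 / (K + 1) ^ 2)]
  have h1 : 1 / ((K : ℝ) + 1) ^ 2 * |T| ≤ 1 / (K + 1) := by
    calc _ ≤ 1 / ((K : ℝ) + 1) ^ 2 * (K + 1) := by gcongr
      _ = _ := by field_simp
  have h2 : (1 - η) * (1 / ((K : ℝ) + 1) ^ 2 * |T|) ≤ (1 - η) * (1 / (K + 1)) := by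
    gcongr
  have h3 : η * |r| ≤ η * 1 := by gcongr
  have h4 : (1 - η) / ((K : ℝ) + 1) = (1 - η) * (1 / (K + 1)) := div_eq_mul_one_div _ _
  linarith

/-- Fejér's kernel may vanish on the circle; the summand `η * w` restores strict positivity of the
real part. -/
theorem transferAvoids_fejerGain_of_pos {K : ℕ} {η μs : ℝ} (hη0 : 0 < η) (hη1 : η ≤ 1)
    (hμs : 0 < μs) (hη : (1 - η) / (K + 1) + η ≤ 1 / √μs) :
    TransferAvoids (fejerGain K η) μs := by
  refine transferAvoids_fejerGain hη0.le hη1 hμs (fun w hw hre => ?_) hη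
  have h1 := fejerSum_re_nonneg (K + 1) hw hre
  rw [transfer_fejerGain, Complex.add_re, Complex.re_ofReal_mul, Complex.re_ofReal_mul,
    Complex.re_ofReal_mul]
  have h2 : 0 ≤ (1 - η) * (1 / ((K : ℝ) + 1) ^ 2 * (fejerSum (K + 1) w).re) :=
    mul_nonneg (by linarith) (mul_nonneg (by positivity) h1)
  have h3 : 0 < η * w.re := mul_pos hη0 hre
  linarith

/-- Here `(3 w + w ^ 3) / 4` has positive real part for `0 < w.re` without any `η`, so the height
bound `1/2 = 1/√4` may be met with equality. -/
theorem transferAvoids_fejerGain_one_four : TransferAvoids (fejerGain 1 0) 4 := by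
  refine transferAvoids_fejerGain le_rfl zero_le_one (by norm_num) (fun w hw hre => ?_) ?_
  · have h1 : (w ^ 3).re = w.re ^ 3 - 3 * w.re * w.im ^ 2 := by
      simp [pow_succ, Complex.mul_re, Complex.mul_im]; ring
    have h2 : w.re ^ 2 + w.im ^ 2 ≤ 1 := by
      have := Complex.sq_norm w
      rw [Complex.normSq_apply] at this
      nlinarith [norm_nonneg w]
    have h3 : (transfer (fejerGain 1 0) w).re = (3 * w.re + (w ^ 3).re) / 4 := by
      simp only [transfer, fejerGain, Fin.sum_univ_one, Complex.add_re, Complex.re_ofReal_mul,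
        Complex.sub_re]
      norm_num
      ring
    rw [h3, h1]
    have h4 : 0 < w.re * (3 + w.re ^ 2 - 3 * w.im ^ 2) := mul_pos hre (by nlinarith)
    nlinarith
  · have : √(4 : ℝ) = 2 := by
      rw [show (4 : ℝ) = 2 ^ 2 by norm_num, Real.sqrt_sq (by norm_num)]
    rw [this]; norm_num

/-! ### Sampling at the roots of unity and the crossing polynomial -/

/-- The mean of a polynomial in `cos θ` over the `N` equidistant points `θ = 2πj/N`. -/
noncomputable def sampleMean (N : ℕ) (p : ℝ[X]) : ℝ :=
  (∑ j ∈ Finset.range N, p.eval (Real.cos (2 * Real.pi * j / N))) / N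

theorem sampleMean_add (N : ℕ) (p q : ℝ[X]) :
    sampleMean N (p + q) = sampleMean N p + sampleMean N q := by
  simp [sampleMean, Finset.sum_add_distrib, add_div]

theorem sampleMean_C_mul (N : ℕ) (c : ℝ) (p : ℝ[X]) :
    sampleMean N (C c * p) = c * sampleMean N p := by
  simp [sampleMean, ← Finset.mul_sum, mul_div_assoc]

theorem sampleMean_sub (N : ℕ) (p q : ℝ[X]) :
    sampleMean N (p - q) = sampleMean N p - sampleMean N q := by
  simp [sampleMean, Finset.sum_sub_distrib, sub_div]

theorem sampleMean_sum {ι : Type*} (N : ℕ) (s : Finset ι) (p : ι → ℝ[X]) :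
    sampleMean N (∑ i ∈ s, p i) = ∑ i ∈ s, sampleMean N (p i) := by
  simp only [sampleMean, eval_finsetSum, ← Finset.sum_div]
  rw [Finset.sum_comm]

theorem sampleMean_one {N : ℕ} (hN : 0 < N) : sampleMean N 1 = 1 := by
  have : (N : ℝ) ≠ 0 := by positivity
  simp [sampleMean, this]

theorem sum_range_cos_eq_zero {N i : ℕ} (hi : 0 < i) (hiN : i < N) :
    ∑ j ∈ Finset.range N, Real.cos (i * (2 * Real.pi * j / N)) = 0 := by
  have hN : (N : ℂ) ≠ 0 := by exact_mod_cast (by omega : N ≠ 0)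
  have hz := Complex.isPrimitiveRoot_exp N (by omega)
  set z := Complex.exp (2 * Real.pi * Complex.I / N) with hzdef
  have hne : z ^ i ≠ 1 := hz.pow_ne_one_of_pos_of_lt hi.ne' hiN
  have hsum : ∑ j ∈ Finset.range N, (z ^ i) ^ j = 0 := by
    have h := geom_sum_mul (z ^ i) N
    rw [← pow_mul, mul_comm i N, pow_mul, hz.pow_eq_one, one_pow, sub_self] at h
    exact (mul_eq_zero.1 h).resolve_right (sub_ne_zero.2 hne)
  have := congrArg Complex.re hsum
  rw [Complex.re_sum, Complex.zero_re] at this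
  rw [← this]
  refine Finset.sum_congr rfl fun j _ => ?_
  rw [hzdef, ← pow_mul, ← Complex.exp_nat_mul]
  have : ((i * j : ℕ) : ℂ) * (2 * Real.pi * Complex.I / N) =
      ((i * (2 * Real.pi * j / N) : ℝ) : ℂ) * Complex.I := by
    push_cast; field_simp
  rw [this, Complex.exp_ofReal_mul_I_re]

theorem sampleMean_T {N i : ℕ} (hi : 0 < i) (hiN : i < N) :
    sampleMean N (Chebyshev.T ℝ i) = 0 := by
  simp only [sampleMean, Chebyshev.T_real_cos, Int.cast_natCast]
  rw [sum_range_cos_eq_zero hi hiN, zero_div]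

/-- The recursion of `T` gives quotients `2 T_{j+1} + 2x q_{j+1} - q_j`. Since `T_{j+1}` has mean
zero for `0 < j + 1 < N`, the means obey the recursion of `U`, as far as `j ≤ N`. -/
theorem exists_quotient_T (x : ℝ) {N : ℕ} (hN : 0 < N) (j : ℕ) :
    (∃ q : ℝ[X], Chebyshev.T ℝ j = (X - C x) * q + C ((Chebyshev.T ℝ j).eval x) ∧
      (j ≤ N → sampleMean N q = (Chebyshev.U ℝ (j - 1)).eval x)) := by
  induction j using Nat.twoStepInduction with
  | zero => exact ⟨0, by simp, fun _ => by simp [sampleMean]⟩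
  | one => exact ⟨1, by simp, fun _ => by simp [sampleMean_one hN]⟩
  | more j ih₀ ih₁ =>
    obtain ⟨q₀, h₀, s₀⟩ := ih₀
    obtain ⟨q₁, h₁, s₁⟩ := ih₁
    have hT : Chebyshev.T ℝ ((j + 2 : ℕ) : ℤ) =
        2 * X * Chebyshev.T ℝ ((j + 1 : ℕ) : ℤ) - Chebyshev.T ℝ (j : ℤ) := by
      push_cast; exact Chebyshev.T_add_two ℝ j
    refine ⟨C 2 * Chebyshev.T ℝ ((j + 1 : ℕ) : ℤ) + C (2 * x) * q₁ - q₀, ?_, fun hj => ?_⟩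
    · have e : eval x (Chebyshev.T ℝ ((j + 2 : ℕ) : ℤ)) =
          2 * x * eval x (Chebyshev.T ℝ ((j + 1 : ℕ) : ℤ)) - eval x (Chebyshev.T ℝ (j : ℤ)) := by
        rw [hT]; simp
      rw [e, hT]
      have h2 : (C 2 : ℝ[X]) = 2 := rfl
      simp only [C_sub, C_mul, h2]
      linear_combination (2 * C x) * h₁ - h₀
    · rw [sampleMean_sub, sampleMean_add, sampleMean_C_mul, sampleMean_C_mul,
        sampleMean_T (by omega) (by omega), s₁ (by omega), s₀ (by omega)]
      have hU : Chebyshev.U ℝ (((j + 2 : ℕ) : ℤ) - 1) = 2 * X * Chebyshev.U ℝ (j : ℤ) -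
          Chebyshev.U ℝ ((j : ℤ) - 1) := by
        have := Chebyshev.U_add_one ℝ (j : ℤ)
        rw [← this]; congr 1; push_cast; ring
      have e1 : (((j + 1 : ℕ) : ℤ) - 1) = j := by push_cast; ring
      rw [hU, e1]; simp

/-- On the unit circle `2 cos t * Re (transfer ε (exp (i t)))` is this polynomial in `cos 2t`. -/
noncomputable def crossPoly {K : ℕ} (ε : Fin K → ℝ) : ℝ[X] :=
  1 + X + ∑ j : Fin K, C (ε j) *
    (Chebyshev.T ℝ ((j : ℕ) + 2 : ℕ) - Chebyshev.T ℝ ((j : ℕ) : ℤ))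

/-- On the unit circle `Im (transfer ε (exp (i t))) / sin t` is this polynomial in `cos 2t`. -/
noncomputable def heightFun {K : ℕ} (ε : Fin K → ℝ) (x : ℝ) : ℝ :=
  1 + 2 * ∑ j : Fin K, ε j * (Chebyshev.T ℝ ((j : ℕ) + 1 : ℕ)).eval x

/-- Averaging the quotients of `T_{j+2} - T_j` gives `U_{j+1} - U_{j-1} = 2 T_{j+1}` at `x`. The top
index `K + 1` is the last one that `K + 1` sample points allow. -/
theorem sampleMean_of_crossPoly_eq {K : ℕ} {ε : Fin K → ℝ} {x : ℝ} {G : ℝ[X]}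
    (h : crossPoly ε = (X - C x) * G) : sampleMean (K + 1) G = heightFun ε x := by
  choose q hq hs using fun j => exists_quotient_T x (Nat.succ_pos K) j
  have hB : crossPoly ε = (X - C x) * (1 + ∑ j : Fin K, C (ε j) * (q (j + 2) - q j)) +
      C ((crossPoly ε).eval x) := by
    have h1 : ∀ j : Fin K, C (ε j) * (Chebyshev.T ℝ ((j : ℕ) + 2 : ℕ) -
        Chebyshev.T ℝ ((j : ℕ) : ℤ)) = (X - C x) * (C (ε j) * (q (j + 2) - q j)) +
        C (ε j * ((Chebyshev.T ℝ ((j : ℕ) + 2 : ℕ)).eval x -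
          (Chebyshev.T ℝ ((j : ℕ) : ℤ)).eval x)) := by
      intro j
      rw [C_mul, C_sub]
      linear_combination C (ε j) * (hq (j + 2)) - C (ε j) * (hq j)
    have h2 : (crossPoly ε).eval x = 1 + x + ∑ j : Fin K, ε j *
        ((Chebyshev.T ℝ ((j : ℕ) + 2 : ℕ)).eval x - (Chebyshev.T ℝ ((j : ℕ) : ℤ)).eval x) := by
      simp [crossPoly, eval_finsetSum]
    rw [h2, crossPoly, Finset.sum_congr rfl fun j _ => h1 j, Finset.sum_add_distrib,
      ← Finset.mul_sum, C_add, C_add, C_1, map_sum]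
    ring
  have h0 : (crossPoly ε).eval x = 0 := by rw [h]; simp
  rw [h0, C_0, add_zero, h] at hB
  rw [mul_left_cancel₀ (X_sub_C_ne_zero x) hB, sampleMean_add, sampleMean_one (Nat.succ_pos K),
    sampleMean_sum, heightFun, Finset.mul_sum]
  congr 1
  refine Finset.sum_congr rfl fun j _ => ?_
  have hj := j.2
  rw [sampleMean_C_mul, sampleMean_sub, hs _ (by omega), hs _ (by omega)]
  have hU := Chebyshev.two_mul_T_eq_U_sub_U ℝ ((j : ℕ) - 1 : ℤ)
  have e1 : ((j : ℕ) - 1 : ℤ) + 2 = (((j : ℕ) + 1 : ℕ) : ℤ) := by push_cast; ring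
  have e2 : ((((j : ℕ) + 2 : ℕ) : ℤ) - 1) = (((j : ℕ) + 1 : ℕ) : ℤ) := by push_cast; ring
  rw [e1] at hU
  have hU' := congrArg (eval x) hU
  rw [eval_sub, eval_mul, eval_ofNat] at hU'
  rw [e2, ← hU']; ring

theorem eval_crossPoly_cos {K : ℕ} (ε : Fin K → ℝ) (θ : ℝ) :
    (crossPoly ε).eval (Real.cos θ) = 1 + Real.cos θ -
      2 * Real.sin θ * ∑ j : Fin K, ε j * Real.sin (((j : ℕ) + 1) * θ) := by
  simp only [crossPoly, eval_add, eval_one, eval_X, eval_finsetSum, eval_mul, eval_C, eval_sub,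
    Chebyshev.T_real_cos]
  rw [sub_eq_add_neg _ (2 * _ * _), Finset.mul_sum, ← Finset.sum_neg_distrib]
  congr 1
  refine Finset.sum_congr rfl fun j _ => ?_
  push_cast
  rw [Real.cos_sub_cos]
  have e1 : (((j : ℕ) + 2 : ℝ) * θ + (j : ℕ) * θ) / 2 = ((j : ℕ) + 1) * θ := by ring
  have e2 : (((j : ℕ) + 2 : ℝ) * θ - (j : ℕ) * θ) / 2 = θ := by ring
  rw [e1, e2]; ring

theorem eval_derivative_crossPoly_cos {K : ℕ} (ε : Fin K → ℝ) (θ : ℝ) :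
    (derivative (crossPoly ε)).eval (Real.cos θ) * Real.sin θ = Real.sin θ +
      2 * Real.sin θ * ∑ j : Fin K, ((j : ℕ) + 1) * (ε j * Real.cos (((j : ℕ) + 1) * θ)) +
      2 * Real.cos θ * ∑ j : Fin K, ε j * Real.sin (((j : ℕ) + 1) * θ) := by
  have hT : ∀ n : ℤ, (derivative (Chebyshev.T ℝ n)).eval (Real.cos θ) * Real.sin θ =
      n * Real.sin (n * θ) := by
    intro n
    have h := Chebyshev.U_real_cos θ (n - 1)
    rw [Chebyshev.T_derivative_eq_U]
    push_cast at h
    rw [sub_add_cancel] at h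
    simp only [eval_mul, eval_intCast]
    rw [mul_assoc, h]
  simp only [crossPoly, derivative_add, derivative_one, derivative_X, derivative_sum,
    derivative_C_mul, derivative_sub, eval_add, eval_one, eval_finsetSum, eval_mul, eval_C,
    eval_sub, zero_add]
  rw [add_mul, one_mul, Finset.sum_mul, Finset.mul_sum, Finset.mul_sum, add_assoc,
    ← Finset.sum_add_distrib]
  congr 1
  refine Finset.sum_congr rfl fun j _ => ?_
  rw [mul_assoc, sub_mul, hT, hT]
  push_cast
  have e1 : ((j : ℕ) + 2 : ℝ) * θ = ((j : ℕ) + 1) * θ + θ := by ring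
  have e2 : ((j : ℕ) : ℝ) * θ = ((j : ℕ) + 1) * θ - θ := by ring
  rw [e1, e2, Real.sin_add, Real.sin_sub]; ring

theorem heightFun_cos {K : ℕ} (ε : Fin K → ℝ) (θ : ℝ) : heightFun ε (Real.cos θ) =
    1 + 2 * ∑ j : Fin K, ε j * Real.cos (((j : ℕ) + 1) * θ) := by
  simp [heightFun, Chebyshev.T_real_cos]

theorem transfer_exp {K : ℕ} (ε : Fin K → ℝ) (t : ℝ) :
    transfer ε (Complex.exp (t * Complex.I)) = Complex.exp (t * Complex.I) +
      2 * Real.sin t * Complex.I * ∑ j : Fin K,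
        (ε j : ℂ) * Complex.exp (((((j : ℕ) + 1) * (2 * t) : ℝ) : ℂ) * Complex.I) := by
  rw [transfer, Finset.mul_sum]
  congr 1
  refine Finset.sum_congr rfl fun j _ => ?_
  have h1 : ∀ n : ℕ, Complex.exp (t * Complex.I) ^ n = Complex.exp ((n * t) * Complex.I) := by
    intro n; rw [← Complex.exp_nat_mul]; congr 1; ring
  have h2 : 2 * (Real.sin t : ℂ) * Complex.I =
      Complex.exp (t * Complex.I) - Complex.exp (-t * Complex.I) := by
    rw [Complex.ofReal_sin, Complex.two_sin]; ring_nf; rw [Complex.I_sq]; ring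
  rw [h1, h1, h2]
  have h3 : Complex.exp (((2 * (j : ℕ) + 3 : ℕ) * t) * Complex.I) =
      Complex.exp (t * Complex.I) *
        Complex.exp (((((j : ℕ) + 1) * (2 * t) : ℝ) : ℂ) * Complex.I) := by
    rw [← Complex.exp_add]; congr 1; push_cast; ring
  have h4 : Complex.exp (((2 * (j : ℕ) + 1 : ℕ) * t) * Complex.I) =
      Complex.exp (-t * Complex.I) *
        Complex.exp (((((j : ℕ) + 1) * (2 * t) : ℝ) : ℂ) * Complex.I) := by
    rw [← Complex.exp_add]; congr 1; push_cast; ring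
  rw [h3, h4]; ring

theorem transfer_exp_re {K : ℕ} (ε : Fin K → ℝ) (t : ℝ) :
    2 * Real.cos t * (transfer ε (Complex.exp (t * Complex.I))).re =
      (crossPoly ε).eval (Real.cos (2 * t)) := by
  have h : (transfer ε (Complex.exp (t * Complex.I))).re = Real.cos t -
      2 * Real.sin t * ∑ j : Fin K, ε j * Real.sin (((j : ℕ) + 1) * (2 * t)) := by
    have e : (2 * (Real.sin t : ℂ) * Complex.I) = ((2 * Real.sin t : ℝ) : ℂ) * Complex.I := by
      push_cast; ring
    rw [transfer_exp, Complex.add_re, Complex.exp_ofReal_mul_I_re, e, mul_assoc,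
      Complex.re_ofReal_mul, Complex.I_mul_re, Complex.im_sum]
    simp only [Complex.im_ofReal_mul, Complex.exp_ofReal_mul_I_im]
    ring
  rw [h, eval_crossPoly_cos, Real.cos_two_mul, Real.sin_two_mul]
  ring

theorem transfer_exp_im {K : ℕ} (ε : Fin K → ℝ) (t : ℝ) :
    (transfer ε (Complex.exp (t * Complex.I))).im =
      Real.sin t * heightFun ε (Real.cos (2 * t)) := by
  have e : (2 * (Real.sin t : ℂ) * Complex.I) = ((2 * Real.sin t : ℝ) : ℂ) * Complex.I := by
    push_cast; ring
  rw [transfer_exp, Complex.add_im, Complex.exp_ofReal_mul_I_im, e, mul_assoc,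
    Complex.im_ofReal_mul, Complex.I_mul_im, Complex.re_sum, heightFun_cos]
  simp only [Complex.re_ofReal_mul, Complex.exp_ofReal_mul_I_re]
  ring

theorem sum_fin_sub (K : ℕ) : ∑ j : Fin K, ((K : ℝ) - (j : ℕ)) = K * (K + 1) / 2 := by
  rw [← Finset.sum_range (fun j => (K : ℝ) - j)]
  have : ∀ n : ℕ, ∑ j ∈ Finset.range n, ((K : ℝ) - j) = n * K - n * (n - 1) / 2 := by
    intro n
    induction n with
    | zero => simp
    | succ n ih => rw [Finset.sum_range_succ, ih]; push_cast; ring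
  rw [this]; ring

/-- At a crossing of the imaginary axis in the clockwise direction and at height at least `1`,
gains bounded by `1` force a lower bound on the height. -/
theorem lt_heightFun_of_derivative_nonpos {K : ℕ} {ε : Fin K → ℝ} (hε : ∀ j, |ε j| ≤ 1) {x : ℝ}
    (hx : x ∈ Set.Ioo (-1 : ℝ) 1) (h0 : (crossPoly ε).eval x = 0)
    (h1 : (derivative (crossPoly ε)).eval x ≤ 0) (hpos : 0 < heightFun ε x)
    (hS : 2 / (1 - x) ≤ heightFun ε x ^ 2) : 2 / ((K + 1) * (1 - x)) < heightFun ε x := by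
  set θ := Real.arccos x with hθ
  have hcos : Real.cos θ = x := Real.cos_arccos hx.1.le hx.2.le
  have hsin : 0 < Real.sin θ := by
    rw [hθ, Real.sin_arccos]; apply Real.sqrt_pos.2; nlinarith [hx.1, hx.2]
  have hsq := Real.sin_sq_add_cos_sq θ
  have e0 := eval_crossPoly_cos ε θ
  have e1 := eval_derivative_crossPoly_cos ε θ
  have eW := heightFun_cos ε θ
  set Sg := ∑ j : Fin K, ε j * Real.sin (((j : ℕ) + 1) * θ)
  set Mc := ∑ j : Fin K, ((j : ℕ) + 1) * (ε j * Real.cos (((j : ℕ) + 1) * θ)) with hMc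
  set Sc := ∑ j : Fin K, ε j * Real.cos (((j : ℕ) + 1) * θ) with hSc
  rw [hcos] at e0 e1 eW hsq
  rw [h0] at e0
  set W := heightFun ε x
  have hx1 : 0 < 1 - x := by linarith [hx.2]
  have hx2 : 0 < 1 + x := by linarith [hx.1]
  -- The derivative condition, with the sine sum `Sg` eliminated through the vanishing of
  -- `crossPoly`.
  have h2 : 1 + 2 * (1 - x) * Mc ≤ 0 := by
    have h3 : (derivative (crossPoly ε)).eval x * Real.sin θ * Real.sin θ ≤ 0 := by
      have : 0 ≤ Real.sin θ * Real.sin θ := by positivity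
      nlinarith
    rw [e1] at h3
    have h4 : (1 + x) * (1 + 2 * (1 - x) * Mc) ≤ 0 := by
      have h5 : Real.sin θ ^ 2 = (1 - x) * (1 + x) := by linarith
      have h6 : (Real.sin θ + 2 * Real.sin θ * Mc + 2 * x * Sg) * Real.sin θ =
          (1 + x) * (1 + 2 * (1 - x) * Mc) := by
        linear_combination (1 + 2 * Mc) * h5 + x * e0
      linarith
    by_contra h7
    rw [not_le] at h7
    have := mul_pos hx2 h7
    linarith
  -- The left side is `∑ (K - j) ε_j cos ((j + 1) θ)` with nonnegative factors `K - j`; this is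
  -- where the gain bound enters.
  have h3 : (K + 1) * Sc - Mc ≤ K * (K + 1) / 2 := by
    rw [← sum_fin_sub, hSc, hMc, Finset.mul_sum, ← Finset.sum_sub_distrib]
    refine Finset.sum_le_sum fun j _ => ?_
    have hj : ((j : ℕ) : ℝ) ≤ K := by exact_mod_cast j.2.le
    have hb : ε j * Real.cos (((j : ℕ) + 1) * θ) ≤ 1 := by
      refine (le_abs_self _).trans ?_
      rw [abs_mul]
      exact mul_le_one₀ (hε j) (abs_nonneg _) (Real.abs_cos_le_one _)
    nlinarith
  by_contra hcon
  rw [not_lt] at hcon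
  have hK : (0 : ℝ) < K + 1 := by positivity
  have h4 : (K + 1) * W ≤ 2 / (1 - x) := by
    calc (K + 1) * W ≤ (K + 1) * (2 / ((K + 1) * (1 - x))) := by gcongr
      _ = 2 / (1 - x) := by field_simp
  -- This contradicts `(K + 1) W ≤ (K + 1)² + 2 Mc`, which is `h3`, because `Mc < 0`.
  have h5 : (K + 1 : ℝ) ≤ W := by
    have : (K + 1) * W ≤ W * W := by nlinarith
    exact le_of_mul_le_mul_right this hpos
  have hMc0 : Mc < 0 := by
    by_contra h6
    rw [not_lt] at h6
    have : 0 ≤ 2 * (1 - x) * Mc := by positivity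
    linarith
  nlinarith

/-! ### Sign changes of a real polynomial -/

/-- A real polynomial is the product of its sign changes in `(-1, 1)` and a factor of constant
sign on `[-1, 1]`. -/
theorem exists_sign_change_factorization (p : ℝ[X]) (hp : p ≠ 0) :
    ∃ (Z : Finset ℝ) (E : ℝ[X]), (∀ z ∈ Z, z ∈ Set.Ioo (-1 : ℝ) 1) ∧
      p = (∏ z ∈ Z, (X - C z)) * E ∧
      ((∀ x ∈ Set.Icc (-1 : ℝ) 1, 0 ≤ E.eval x) ∨ ∀ x ∈ Set.Icc (-1 : ℝ) 1, E.eval x ≤ 0) := by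
  induction hn : p.natDegree using Nat.strong_induction_on generalizing p with
  | _ n ih =>
    by_cases hsign : (∀ x ∈ Set.Icc (-1 : ℝ) 1, 0 ≤ p.eval x) ∨
        ∀ x ∈ Set.Icc (-1 : ℝ) 1, p.eval x ≤ 0
    · exact ⟨∅, p, by simp, by simp, hsign⟩
    · push Not at hsign
      obtain ⟨⟨x, hx, hpx⟩, y, hy, hpy⟩ := hsign
      obtain ⟨z, hz, hpz⟩ : ∃ z ∈ Set.uIcc x y, p.eval z = 0 := by
        have := intermediate_value_uIcc (f := fun t => p.eval t) (a := x) (b := y)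
          p.continuous.continuousOn
        exact this (Set.mem_uIcc.2 (Or.inl ⟨hpx.le, hpy.le⟩))
      have hzx : z ≠ x := by rintro rfl; linarith
      have hzy : z ≠ y := by rintro rfl; linarith
      have hzI : z ∈ Set.Ioo (-1 : ℝ) 1 := by
        rcases Set.mem_uIcc.1 hz with h | h
        · exact ⟨hx.1.trans_lt (lt_of_le_of_ne h.1 hzx.symm),
            (lt_of_le_of_ne h.2 hzy).trans_le hy.2⟩
        · exact ⟨hy.1.trans_lt (lt_of_le_of_ne h.1 hzy.symm),
            (lt_of_le_of_ne h.2 hzx).trans_le hx.2⟩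
      obtain ⟨q, hq⟩ := dvd_iff_isRoot.2 (show p.IsRoot z from hpz)
      have hq0 : q ≠ 0 := by rintro rfl; exact hp (by simpa using hq)
      have hdeg : q.natDegree < n := by
        rw [← hn, hq, natDegree_mul (X_sub_C_ne_zero z) hq0, natDegree_X_sub_C]; omega
      obtain ⟨Z, E, hZ, hqE, hE⟩ := ih _ hdeg q hq0 rfl
      by_cases hzZ : z ∈ Z
      -- A second factor at `z` cancels the sign change and joins `E` as a square.
      · refine ⟨Z.erase z, (X - C z) ^ 2 * E, fun w hw => hZ w (Finset.mem_of_mem_erase hw), ?_, ?_⟩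
        · rw [hq, hqE, ← Finset.mul_prod_erase Z _ hzZ]; ring
        · refine hE.imp (fun h w hw => ?_) (fun h w hw => ?_)
          · rw [eval_mul, eval_pow]; exact mul_nonneg (sq_nonneg _) (h w hw)
          · rw [eval_mul, eval_pow]; exact mul_nonpos_of_nonneg_of_nonpos (sq_nonneg _) (h w hw)
      · refine ⟨insert z Z, E, fun w hw => ?_, ?_, hE⟩
        · rcases Finset.mem_insert.1 hw with rfl | hw
          · exact hzI
          · exact hZ w hw
        · rw [Finset.prod_insert hzZ, hq, hqE, mul_assoc]

/-! ### Continuous arguments of polynomials without zeros in the disc -/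

/-- In `w - z = (-z) (1 - w / z)` the second factor stays in the slit plane, where the principal
argument is continuous. -/
theorem exists_continuousOn_arg_prod (s : Multiset ℂ) (hs : ∀ z ∈ s, 1 < ‖z‖) :
    ∃ α : ℂ → ℝ, ContinuousOn α (Metric.closedBall 0 1) ∧ ∀ w, ‖w‖ ≤ 1 →
      (s.map fun z => X - C z).prod.eval w =
        ‖(s.map fun z => X - C z).prod.eval w‖ * Complex.exp (α w * Complex.I) := by
  induction s using Multiset.induction_on with
  | empty => exact ⟨fun _ => 0, continuousOn_const, fun w _ => by simp⟩
  | cons z s ih =>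
    obtain ⟨α, hα, h⟩ := ih fun z hz => hs z (Multiset.mem_cons_of_mem hz)
    have hz : 1 < ‖z‖ := hs z (Multiset.mem_cons_self z s)
    have hz0 : z ≠ 0 := by rintro rfl; norm_num at hz
    have hslit : ∀ w, ‖w‖ ≤ 1 → 1 - w / z ∈ Complex.slitPlane := by
      intro w hw
      refine Complex.mem_slitPlane_of_norm_lt_one (z := -(w / z)) ?_
      rw [norm_neg, norm_div, div_lt_one (by linarith)]; linarith
    refine ⟨fun w => α w + (Complex.arg (-z) + Complex.arg (1 - w / z)), ?_, fun w hw => ?_⟩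
    · refine hα.add (continuousOn_const.add fun w hw => ?_)
      have h1 := Complex.continuousAt_arg (hslit w (by simpa using hw))
      have h2 : ContinuousAt (fun w : ℂ => 1 - w / z) w := by fun_prop
      exact (ContinuousAt.comp (f := fun w : ℂ => 1 - w / z) h1 h2).continuousWithinAt
    · have h1 : w - z = ‖w - z‖ * Complex.exp ((Complex.arg (-z) + Complex.arg (1 - w / z) : ℝ) *
          Complex.I) := by
        have h2 : w - z = (-z) * (1 - w / z) := by field_simp; ring
        have h3 := Complex.norm_mul_exp_arg_mul_I (-z)
        have h4 := Complex.norm_mul_exp_arg_mul_I (1 - w / z)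
        rw [h2, norm_mul]
        push_cast
        rw [add_mul, Complex.exp_add]
        nth_rewrite 1 [← h3, ← h4]
        ring
      rw [Multiset.map_cons, Multiset.prod_cons, eval_mul, eval_sub, eval_X, eval_C, norm_mul]
      nth_rewrite 1 [h1, h w hw]
      push_cast
      rw [add_mul (α w : ℂ), Complex.exp_add]
      ring

theorem exists_continuousOn_arg (p : ℂ[X]) (hp : ∀ w : ℂ, ‖w‖ ≤ 1 → p.eval w ≠ 0) :
    ∃ α : ℂ → ℝ, ContinuousOn α (Metric.closedBall 0 1) ∧ ∀ w, ‖w‖ ≤ 1 →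
      p.eval w = ‖p.eval w‖ * Complex.exp (α w * Complex.I) := by
  have hsplit := (IsAlgClosed.splits p).eq_prod_roots
  have hp0 : p ≠ 0 := by rintro rfl; exact hp 0 (by simp) (by simp)
  obtain ⟨α, hα, h⟩ := exists_continuousOn_arg_prod p.roots fun z hz => by
    by_contra hz1
    exact hp z (not_lt.1 hz1) ((mem_roots hp0).1 hz)
  refine ⟨fun w => Complex.arg p.leadingCoeff + α w, continuousOn_const.add hα, fun w hw => ?_⟩
  have h1 := Complex.norm_mul_exp_arg_mul_I p.leadingCoeff
  have h2 : p.eval w = p.leadingCoeff * (p.roots.map fun z => X - C z).prod.eval w := by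
    conv_lhs => rw [hsplit]
    rw [eval_mul, eval_C]
  rw [h2, norm_mul]
  nth_rewrite 1 [h w hw, ← h1]
  push_cast
  rw [add_mul, Complex.exp_add]
  ring

/-! ### Counting crossings by a continuous argument -/

/-- On leaving the band, `|β|` would take a value in `(π/2, π]`, where the cosine is negative. -/
theorem abs_le_pi_div_two_of_cos_nonneg {β : ℝ → ℝ} {u v : ℝ} (hβ : ContinuousOn β (Set.Icc u v))
    (hcos : ∀ t ∈ Set.Icc u v, 0 ≤ Real.cos (β t)) (hu : |β u| ≤ Real.pi / 2) {t : ℝ}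
    (ht : t ∈ Set.Icc u v) : |β t| ≤ Real.pi / 2 := by
  have hpi := Real.pi_pos
  by_contra hcon
  rw [not_le] at hcon
  have habs : ContinuousOn (fun t => |β t|) (Set.Icc u t) :=
    (hβ.mono (Set.Icc_subset_Icc_right ht.2)).abs
  set m := min |β t| Real.pi with hm
  have hm1 : Real.pi / 2 < m := lt_min hcon (by linarith)
  have hmem : m ∈ Set.Icc |β u| |β t| := ⟨by linarith, min_le_left _ _⟩
  obtain ⟨r, hr, hrm⟩ := intermediate_value_Icc ht.1 habs hmem
  have h1 := hcos r ⟨hr.1, hr.2.trans ht.2⟩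
  rw [← Real.cos_abs] at h1
  have h2 : Real.cos |β r| < 0 := by
    change |β r| = m at hrm
    rw [hrm]
    refine Real.cos_neg_of_pi_div_two_lt_of_lt hm1 ?_
    have : m ≤ Real.pi := min_le_right _ _
    linarith
  linarith

theorem cos_sub_pi_mul_int (a : ℝ) (l : ℤ) :
    Real.cos (a - Real.pi * l) = (-1) ^ l * Real.cos a := by
  rw [mul_comm, Real.cos_sub_int_mul_pi]

theorem sin_sub_pi_mul_int (a : ℝ) (l : ℤ) :
    Real.sin (a - Real.pi * l) = (-1) ^ l * Real.sin a := by
  rw [mul_comm, Real.sin_sub_int_mul_pi]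

/-- The elements of `Z` above `x`. -/
noncomputable def aboveSet (Z : Finset ℝ) (x : ℝ) : Finset ℝ := Z.filter (x < ·)

/-- The crossings at which the argument `α` of the curve increases. -/
noncomputable def risingSet (Z : Finset ℝ) (α : ℝ → ℝ) : Finset ℝ :=
  Z.filter fun z => 0 < (-1 : ℝ) ^ (aboveSet Z z).card * Real.sin (α (Real.arccos z / 2))

/-- The index of the half-plane sheet in which the argument lies after the crossings above `x`. -/
noncomputable def sheetIndex (Z : Finset ℝ) (α : ℝ → ℝ) (x : ℝ) : ℤ :=
  2 * (aboveSet (risingSet Z α) x).card - (aboveSet Z x).card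

theorem neg_one_zpow_sheetIndex (Z : Finset ℝ) (α : ℝ → ℝ) (x : ℝ) :
    (-1 : ℝ) ^ sheetIndex Z α x = (-1) ^ (aboveSet Z x).card := by
  rw [sheetIndex, zpow_sub₀ (by norm_num), zpow_mul]
  have h : ((-1 : ℝ) ^ (aboveSet Z x).card) * (-1) ^ (aboveSet Z x).card = 1 := by
    rw [← mul_pow]; norm_num
  have h2 : ((-1 : ℝ) ^ (2 : ℤ)) = 1 := by norm_num
  rw [h2, one_zpow, zpow_natCast, div_eq_iff (by positivity), h]

/-- Induction on the crossings already passed, which lie above `cos (2 * t)` since this decreases in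
`t`. At the last one the argument is on an edge of its sheet, and the sign change of the cosine
sends it into the neighbouring sheet across that edge, up or down according to `risingSet`. -/
theorem abs_sub_sheetIndex_le {Z : Finset ℝ} {α : ℝ → ℝ}
    (hZ : ∀ z ∈ Z, z ∈ Set.Ioo (-1 : ℝ) 1) (hα : ContinuousOn α (Set.Icc 0 (Real.pi / 2)))
    (h0 : |α 0| ≤ Real.pi / 2) (hnode : ∀ z ∈ Z, Real.cos (α (Real.arccos z / 2)) = 0)
    (hsign : ∀ t ∈ Set.Icc 0 (Real.pi / 2),
      0 ≤ (-1 : ℝ) ^ (aboveSet Z (Real.cos (2 * t))).card * Real.cos (α t)) {t : ℝ}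
    (ht : t ∈ Set.Icc 0 (Real.pi / 2)) :
    |α t - Real.pi * sheetIndex Z α (Real.cos (2 * t))| ≤ Real.pi / 2 := by
  have hpi := Real.pi_pos
  induction hn : (aboveSet Z (Real.cos (2 * t))).card using Nat.strong_induction_on
    generalizing t with
  | _ n ih =>
  have hcosle : ∀ {u v : ℝ}, 0 ≤ u → u ≤ v → v ≤ Real.pi / 2 →
      Real.cos (2 * v) ≤ Real.cos (2 * u) := fun h1 h2 h3 =>
    Real.cos_le_cos_of_nonneg_of_le_pi (by linarith) (by linarith) (by linarith)
  rcases (aboveSet Z (Real.cos (2 * t))).eq_empty_or_nonempty with hemp | hne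
  · have hidx : sheetIndex Z α (Real.cos (2 * t)) = 0 := by
      have h1 : aboveSet (risingSet Z α) (Real.cos (2 * t)) = ∅ := by
        rw [← Finset.subset_empty, ← hemp]
        exact Finset.filter_subset_filter _ (Finset.filter_subset _ _)
      simp [sheetIndex, h1, hemp]
    rw [hidx]
    simp only [Int.cast_zero, mul_zero, sub_zero]
    refine abs_le_pi_div_two_of_cos_nonneg (u := 0) (v := t)
      (hα.mono (Set.Icc_subset_Icc_right ht.2)) (fun v hv => ?_) h0 ⟨ht.1, le_rfl⟩
    have h1 := hsign v ⟨hv.1, hv.2.trans ht.2⟩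
    have h2 : aboveSet Z (Real.cos (2 * v)) = ∅ := by
      rw [← Finset.subset_empty, ← hemp]
      refine Finset.monotone_filter_right _ fun z _ hz => ?_
      exact (hcosle hv.1 hv.2 ht.2).trans_lt hz
    rwa [h2, Finset.card_empty, pow_zero, one_mul] at h1
  -- The smallest element above `cos (2 * t)` is the last crossing before `t`.
  · set z := (aboveSet Z (Real.cos (2 * t))).min' hne with hz
    have hzmem : z ∈ aboveSet Z (Real.cos (2 * t)) := Finset.min'_mem _ _
    obtain ⟨hzZ, hzt⟩ := Finset.mem_filter.1 hzmem
    have hzI := hZ z hzZ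
    set u := Real.arccos z / 2 with hu
    have hcosu : Real.cos (2 * u) = z := by
      rw [hu, mul_div_cancel₀ _ two_ne_zero, Real.cos_arccos hzI.1.le hzI.2.le]
    have hu0 : 0 ≤ u := by rw [hu]; have := Real.arccos_nonneg z; positivity
    have hu1 : u ≤ Real.pi / 2 := by rw [hu]; have := Real.arccos_le_pi z; linarith
    have hut : u < t := by
      by_contra h
      have := hcosle ht.1 (not_lt.1 h) hu1
      rw [hcosu] at this
      linarith
    have hab : aboveSet Z (Real.cos (2 * t)) = insert z (aboveSet Z z) := by
      ext y
      simp only [aboveSet, Finset.mem_insert, Finset.mem_filter]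
      constructor
      · rintro ⟨h1, h2⟩
        have h3 : z ≤ y := Finset.min'_le _ _ (Finset.mem_filter.2 ⟨h1, h2⟩)
        rcases h3.eq_or_lt with h | h
        · exact Or.inl h.symm
        · exact Or.inr ⟨h1, h⟩
      · rintro (rfl | ⟨h1, h2⟩)
        · exact ⟨hzZ, hzt⟩
        · exact ⟨h1, hzt.trans h2⟩
    have hznot : ∀ s : Finset ℝ, z ∉ aboveSet s z := fun s h =>
      lt_irrefl z (Finset.mem_filter.1 h).2
    have hcard : (aboveSet Z (Real.cos (2 * t))).card = (aboveSet Z z).card + 1 := by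
      rw [hab, Finset.card_insert_of_notMem (hznot Z)]
    have hih := ih (aboveSet Z z).card (by omega) (t := u) ⟨hu0, hu1⟩ (by rw [hcosu])
    rw [hcosu] at hih
    set l := sheetIndex Z α z with hl
    have hcosβ : Real.cos (α u - Real.pi * l) = 0 := by
      rw [cos_sub_pi_mul_int, hnode z hzZ, mul_zero]
    have hpm : α u - Real.pi * l = Real.pi / 2 ∨ α u - Real.pi * l = -(Real.pi / 2) := by
      rw [abs_le] at hih
      by_contra hcon
      push Not at hcon
      have := Real.cos_pos_of_mem_Ioo
        ⟨lt_of_le_of_ne hih.1 (Ne.symm hcon.2), lt_of_le_of_ne hih.2 hcon.1⟩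
      linarith
    have hsinβ : Real.sin (α u - Real.pi * l) = (-1) ^ (aboveSet Z z).card * Real.sin (α u) := by
      rw [sin_sub_pi_mul_int, hl, neg_one_zpow_sheetIndex]
    have hstart : |α u - Real.pi * sheetIndex Z α (Real.cos (2 * t))| ≤ Real.pi / 2 := by
      rcases hpm with h | h
      · have hrise : z ∈ risingSet Z α := by
          refine Finset.mem_filter.2 ⟨hzZ, ?_⟩
          rw [← hsinβ, h, Real.sin_pi_div_two]; norm_num
        have hab' : aboveSet (risingSet Z α) (Real.cos (2 * t)) =
            insert z (aboveSet (risingSet Z α) z) := by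
          ext y
          have := Finset.ext_iff.1 hab y
          simp only [aboveSet, Finset.mem_insert, Finset.mem_filter] at this ⊢
          constructor
          · rintro ⟨h1, h2⟩
            rcases this.1 ⟨(Finset.mem_filter.1 h1).1, h2⟩ with h3 | h3
            · exact Or.inl h3
            · exact Or.inr ⟨h1, h3.2⟩
          · rintro (rfl | ⟨h1, h2⟩)
            · exact ⟨hrise, hzt⟩
            · exact ⟨h1, hzt.trans h2⟩
        have hidx : sheetIndex Z α (Real.cos (2 * t)) = l + 1 := by
          rw [hl, sheetIndex, sheetIndex, hcard, hab', Finset.card_insert_of_notMem (hznot _)]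
          push_cast; ring
        rw [hidx]; push_cast
        rw [abs_le]; constructor <;> linarith
      · have hrise : z ∉ risingSet Z α := by
          intro hmem
          have := (Finset.mem_filter.1 hmem).2
          rw [← hsinβ, h, Real.sin_neg, Real.sin_pi_div_two] at this
          norm_num at this
        have hab' : aboveSet (risingSet Z α) (Real.cos (2 * t)) =
            aboveSet (risingSet Z α) z := by
          ext y
          have := Finset.ext_iff.1 hab y
          simp only [aboveSet, Finset.mem_insert, Finset.mem_filter] at this ⊢
          constructor
          · rintro ⟨h1, h2⟩
            rcases this.1 ⟨(Finset.mem_filter.1 h1).1, h2⟩ with h3 | h3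
            · exact absurd (h3 ▸ h1) hrise
            · exact ⟨h1, h3.2⟩
          · rintro ⟨h1, h2⟩
            exact ⟨h1, hzt.trans h2⟩
        have hidx : sheetIndex Z α (Real.cos (2 * t)) = l - 1 := by
          rw [hl, sheetIndex, sheetIndex, hcard, hab']
          push_cast; ring
        rw [hidx]; push_cast
        rw [abs_le]; constructor <;> linarith
    refine abs_le_pi_div_two_of_cos_nonneg
      (β := fun v => α v - Real.pi * sheetIndex Z α (Real.cos (2 * t))) (u := u) (v := t)
      ((hα.mono (Set.Icc_subset_Icc hu0 ht.2)).sub continuousOn_const) (fun v hv => ?_) hstart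
      ⟨hut.le, le_rfl⟩
    rw [cos_sub_pi_mul_int, neg_one_zpow_sheetIndex]
    rcases hv.1.eq_or_lt with rfl | huv
    · rw [hnode z hzZ, mul_zero]
    · have h1 := hsign v ⟨hu0.trans hv.1, hv.2.trans ht.2⟩
      have h2 : aboveSet Z (Real.cos (2 * v)) = aboveSet Z (Real.cos (2 * t)) := by
        have hv1 : Real.cos (2 * t) ≤ Real.cos (2 * v) :=
          hcosle (hu0.trans hv.1) hv.2 ht.2
        have hv2 : Real.cos (2 * v) < z := by
          rw [← hcosu]
          exact Real.cos_lt_cos_of_nonneg_of_le_pi (by linarith) (by linarith [hv.2, ht.2])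
            (by linarith)
        ext y
        have := Finset.ext_iff.1 hab y
        simp only [aboveSet, Finset.mem_insert, Finset.mem_filter] at this ⊢
        constructor
        · rintro ⟨h3, h4⟩
          exact ⟨h3, hv1.trans_lt h4⟩
        · intro h3
          rcases this.1 h3 with rfl | h4
          · exact ⟨hzZ, hv2⟩
          · exact ⟨h4.1, hv2.trans h4.2⟩
      rwa [h2] at h1

/-! ### The argument of the transfer function -/

theorem exists_transfer_arg {K : ℕ} (ε : Fin K → ℝ) {y : ℝ} (hy : 0 < y)
    (h : ∀ w : ℂ, ‖w‖ ≤ 1 → transfer ε w ≠ y * Complex.I) :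
    ∃ α : ℂ → ℝ, ContinuousOn α (Metric.closedBall 0 1) ∧ α 0 = -(Real.pi / 2) ∧
      ∀ w, ‖w‖ ≤ 1 →
        (transfer ε w).re = ‖transfer ε w - y * Complex.I‖ * Real.cos (α w) ∧
        (transfer ε w).im - y = ‖transfer ε w - y * Complex.I‖ * Real.sin (α w) := by
  set q : ℂ[X] := X + ∑ j : Fin K, C (ε j : ℂ) * (X ^ (2 * (j : ℕ) + 3) - X ^ (2 * (j : ℕ) + 1)) -
    C (y * Complex.I) with hq
  have hqe : ∀ w, q.eval w = transfer ε w - y * Complex.I := by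
    intro w; simp [hq, transfer, eval_finsetSum]
  obtain ⟨α, hα, hrep⟩ := exists_continuousOn_arg q fun w hw => by
    rw [hqe, sub_ne_zero]; exact h w hw
  have hq0 : q.eval 0 = -(y * Complex.I) := by rw [hqe]; simp [transfer]
  have h0 : Complex.exp (α 0 * Complex.I) = -Complex.I := by
    have h1 := hrep 0 (by simp)
    have h2 : ‖-(y * Complex.I)‖ = y := by simp [abs_of_pos hy]
    rw [hq0, h2] at h1
    have hy0 : (y : ℂ) ≠ 0 := by exact_mod_cast hy.ne'
    apply mul_left_cancel₀ hy0
    rw [← h1]; ring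
  refine ⟨fun w => α w - α 0 - Real.pi / 2, (hα.sub continuousOn_const).sub continuousOn_const,
    by ring, fun w hw => ?_⟩
  have hexp : Complex.exp (((α w - α 0 - Real.pi / 2 : ℝ) : ℂ) * Complex.I) =
      Complex.exp (α w * Complex.I) := by
    push_cast
    rw [sub_mul, sub_mul, Complex.exp_sub, Complex.exp_sub, h0, Complex.exp_pi_div_two_mul_I]
    field_simp
    rw [Complex.I_sq]
  have h1 := hrep w hw
  rw [← hexp, hqe] at h1
  constructor
  · have := congrArg Complex.re h1
    rw [Complex.re_ofReal_mul, Complex.exp_ofReal_mul_I_re] at this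
    simpa using this
  · have := congrArg Complex.im h1
    rw [Complex.im_ofReal_mul, Complex.exp_ofReal_mul_I_im] at this
    simpa using this

theorem transfer_ofReal_im {K : ℕ} (ε : Fin K → ℝ) (r : ℝ) : (transfer ε r).im = 0 := by
  have : transfer ε r =
      ((r + ∑ j : Fin K, ε j * (r ^ (2 * (j : ℕ) + 3) - r ^ (2 * (j : ℕ) + 1)) : ℝ) : ℂ) := by
    simp [transfer]
  rw [this, Complex.ofReal_im]

theorem transfer_mul_I_re {K : ℕ} (ε : Fin K → ℝ) (r : ℝ) :
    (transfer ε (r * Complex.I)).re = 0 := by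
  have h1 : transfer ε (r * Complex.I) = ∑ j ∈ Finset.range (K + 1),
      ((weight ε j * r ^ (2 * j + 1) * (-1) ^ j : ℝ) : ℂ) * Complex.I := by
    rw [transfer_eq_sum_weight]
    refine Finset.sum_congr rfl fun j _ => ?_
    rw [mul_pow, pow_succ Complex.I, pow_mul Complex.I, Complex.I_sq]
    push_cast; ring
  rw [h1, Complex.re_sum]
  exact Finset.sum_eq_zero fun j _ => by rw [Complex.re_ofReal_mul]; simp

theorem transfer_one {K : ℕ} (ε : Fin K → ℝ) : transfer ε 1 = 1 := by simp [transfer]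

/-- Along the radius to 1 the curve is real, hence below `y i`, and the argument stays in `[-π, 0]`;
the real part at 1 is positive. -/
theorem transfer_arg_one {K : ℕ} {ε : Fin K → ℝ} {y : ℝ} (hy : 0 < y) {α : ℂ → ℝ}
    (hα : ContinuousOn α (Metric.closedBall 0 1)) (h0 : α 0 = -(Real.pi / 2))
    (h : ∀ w, ‖w‖ ≤ 1 →
        (transfer ε w).re = ‖transfer ε w - y * Complex.I‖ * Real.cos (α w) ∧
        (transfer ε w).im - y = ‖transfer ε w - y * Complex.I‖ * Real.sin (α w)) :
    |α 1| ≤ Real.pi / 2 := by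
  have hpi := Real.pi_pos
  have hnorm : ∀ r ∈ Set.Icc (0 : ℝ) 1, ‖(r : ℂ)‖ ≤ 1 := fun r hr => by
    rw [Complex.norm_real, Real.norm_eq_abs, abs_of_nonneg hr.1]; exact hr.2
  have hcont : ContinuousOn (fun r : ℝ => α r + Real.pi / 2) (Set.Icc 0 1) := by
    refine ContinuousOn.add (hα.comp Complex.continuous_ofReal.continuousOn fun r hr => ?_)
      continuousOn_const
    simpa using hnorm r hr
  have hband := abs_le_pi_div_two_of_cos_nonneg hcont (fun r hr => by
    have h1 := (h r (hnorm r hr)).2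
    rw [transfer_ofReal_im] at h1
    rw [Real.cos_add_pi_div_two]
    by_contra hneg
    have : 0 ≤ ‖transfer ε r - y * Complex.I‖ * Real.sin (α r) :=
      mul_nonneg (norm_nonneg _) (by linarith)
    linarith) (by simp [h0]; positivity) (Set.right_mem_Icc.2 zero_le_one)
  have h1 := (h 1 (by simp)).1
  rw [transfer_one, Complex.one_re] at h1
  simp only [Complex.ofReal_one] at hband
  rw [abs_le] at hband ⊢
  refine ⟨?_, by linarith⟩
  by_contra hlt
  rw [not_le] at hlt
  have hcos : Real.cos (α 1) ≤ 0 := by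
    rw [← Real.cos_neg]
    exact Real.cos_nonpos_of_pi_div_two_le_of_le (by linarith) (by linarith)
  nlinarith [norm_nonneg (1 - (y : ℂ) * Complex.I)]

/-- Along the radius to `i` the curve stays on the imaginary axis and misses `y i`, so the cosine of
the argument vanishes throughout and the argument cannot move. -/
theorem transfer_arg_I {K : ℕ} {ε : Fin K → ℝ} {y : ℝ}
    (hne : ∀ w : ℂ, ‖w‖ ≤ 1 → transfer ε w ≠ y * Complex.I) {α : ℂ → ℝ}
    (hα : ContinuousOn α (Metric.closedBall 0 1)) (h0 : α 0 = -(Real.pi / 2))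
    (h : ∀ w, ‖w‖ ≤ 1 →
        (transfer ε w).re = ‖transfer ε w - y * Complex.I‖ * Real.cos (α w)) :
    α Complex.I = -(Real.pi / 2) := by
  have hpi := Real.pi_pos
  have hnorm : ∀ r ∈ Set.Icc (0 : ℝ) 1, ‖(r : ℂ) * Complex.I‖ ≤ 1 := fun r hr => by
    rw [norm_mul, Complex.norm_I, mul_one, Complex.norm_real, Real.norm_eq_abs,
      abs_of_nonneg hr.1]; exact hr.2
  have hcont : ContinuousOn (fun r : ℝ => |α (r * Complex.I) + Real.pi / 2|) (Set.Icc 0 1) := by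
    refine ContinuousOn.abs (ContinuousOn.add (hα.comp (f := fun r : ℝ => (r : ℂ) * Complex.I)
      (by fun_prop) fun r hr => ?_) continuousOn_const)
    simpa using hnorm r hr
  by_contra hcon
  have hpos : 0 < |α Complex.I + Real.pi / 2| := abs_pos.2 fun h' => hcon (by linarith)
  set m := min |α Complex.I + Real.pi / 2| (Real.pi / 2) with hm
  have hm0 : 0 < m := lt_min hpos (by linarith)
  have hm1 : m ≤ Real.pi / 2 := min_le_right _ _
  obtain ⟨r, hr, hrm⟩ := intermediate_value_Icc (zero_le_one' ℝ) hcont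
    (show m ∈ Set.Icc _ _ from ⟨by simp [h0, hm0.le], by simp [hm]⟩)
  have h1 := h _ (hnorm r hr)
  rw [transfer_mul_I_re] at h1
  have h2 : Real.cos (α (r * Complex.I)) = 0 := by
    refine (mul_eq_zero.1 h1.symm).resolve_left ?_
    exact norm_ne_zero_iff.2 (sub_ne_zero.2 (hne _ (hnorm r hr)))
  have h3 : 0 < Real.sin m := Real.sin_pos_of_pos_of_lt_pi hm0 (by linarith)
  have h4 : Real.sin (α (r * Complex.I) + Real.pi / 2) = 0 := by
    rw [Real.sin_add_pi_div_two, h2]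
  change |α (r * Complex.I) + Real.pi / 2| = m at hrm
  rw [← hrm] at h3
  rcases abs_choice (α (r * Complex.I) + Real.pi / 2) with h5 | h5 <;> rw [h5] at h3
  · linarith
  · rw [Real.sin_neg] at h3; linarith

/-! ### Lagrange interpolation over the crossings -/

theorem eq_sum_C_mul_prod_erase (s : Finset ℝ) {R : ℝ[X]} (hR : R.degree < s.card) :
    R = ∑ k ∈ s, C (R.eval k * ∏ l ∈ s.erase k, (k - l)⁻¹) * ∏ l ∈ s.erase k, (X - C l) := by
  conv_lhs => rw [Lagrange.eq_interpolate (v := id) Function.injective_id.injOn hR]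
  rw [Lagrange.interpolate_apply]
  refine Finset.sum_congr rfl fun k _ => ?_
  rw [Lagrange.basis, C_mul, mul_assoc, map_prod, ← Finset.prod_mul_distrib]
  rfl

theorem neg_one_pow_card_aboveSet_mul_prod (Z : Finset ℝ) (x : ℝ) :
    (-1 : ℝ) ^ (aboveSet Z x).card * ∏ z ∈ Z, (x - z) = ∏ z ∈ Z, |x - z| := by
  rw [aboveSet, ← Finset.prod_const, Finset.prod_filter, ← Finset.prod_mul_distrib]
  refine Finset.prod_congr rfl fun z _ => ?_
  split_ifs with h
  · rw [abs_of_neg (by linarith)]; ring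
  · rw [abs_of_nonneg (by linarith)]; ring

theorem aboveSet_erase_self (Z : Finset ℝ) (x : ℝ) : aboveSet (Z.erase x) x = aboveSet Z x := by
  ext y
  simp only [aboveSet, Finset.mem_filter, Finset.mem_erase]
  constructor
  · rintro ⟨⟨_, h⟩, h'⟩; exact ⟨h, h'⟩
  · rintro ⟨h, h'⟩; exact ⟨⟨h'.ne', h⟩, h'⟩

theorem crossPoly_eval_one {K : ℕ} (ε : Fin K → ℝ) : (crossPoly ε).eval 1 = 2 := by
  have := eval_crossPoly_cos ε 0
  rw [Real.cos_zero, Real.sin_zero] at this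
  rw [this]; ring

/-- The identity behind the lower bound: a weighted sum of the heights of the crossings, compared
with the values of a polynomial at the sampling points. -/
theorem sum_crossing_identity {K : ℕ} {ε : Fin K → ℝ} {s : Finset ℝ} {E R : ℝ[X]}
    (hs : ∀ k ∈ s, k ≠ 1) (hB : crossPoly ε = (∏ z ∈ s, (X - C z)) * E)
    (hR : R.degree < s.card) :
    ∑ k ∈ s, R.eval k * (∏ l ∈ s.erase k, (k - l)⁻¹) *
        (heightFun ε k - 2 / ((K + 1) * (1 - k))) =
      (∑ j ∈ Finset.Ico 1 (K + 1),
        (R * E).eval (Real.cos (2 * Real.pi * j / (K + 1 : ℕ)))) / (K + 1) := by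
  set r : ℝ → ℝ := fun k => R.eval k * ∏ l ∈ s.erase k, (k - l)⁻¹ with hr
  set G : ℝ → ℝ[X] := fun k => (∏ l ∈ s.erase k, (X - C l)) * E with hG
  have hBG : ∀ k ∈ s, crossPoly ε = (X - C k) * G k := by
    intro k hk
    rw [hB, hG, ← mul_assoc, Finset.mul_prod_erase s (fun l => X - C l) hk]
  -- Lagrange interpolation of `R` at the zeros; the quadrature then applies to each quotient `G k`,
  -- and the sample point 1 is split off.
  have hRE : R * E = ∑ k ∈ s, C (r k) * G k := by
    conv_lhs => rw [eq_sum_C_mul_prod_erase s hR]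
    rw [Finset.sum_mul]
    exact Finset.sum_congr rfl fun k _ => mul_assoc _ _ _
  have hG1 : ∀ k ∈ s, (G k).eval 1 = 2 / (1 - k) := by
    intro k hk
    have h1 := congrArg (eval 1) (hBG k hk)
    rw [crossPoly_eval_one, eval_mul, eval_sub, eval_X, eval_C] at h1
    rw [h1]
    field_simp [sub_ne_zero.2 (hs k hk).symm]
  have hK : (K + 1 : ℝ) ≠ 0 := by positivity
  have hmean : sampleMean (K + 1) (R * E) = ∑ k ∈ s, r k * heightFun ε k := by
    rw [hRE, sampleMean_sum]
    refine Finset.sum_congr rfl fun k hk => ?_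
    rw [sampleMean_C_mul, sampleMean_of_crossPoly_eq (hBG k hk)]
  have hone : (R * E).eval 1 = ∑ k ∈ s, r k * (2 / (1 - k)) := by
    rw [hRE, eval_finsetSum]
    refine Finset.sum_congr rfl fun k hk => ?_
    rw [eval_mul, eval_C, hG1 k hk]
  have hsplit : sampleMean (K + 1) (R * E) = ((R * E).eval 1 + ∑ j ∈ Finset.Ico 1 (K + 1),
      (R * E).eval (Real.cos (2 * Real.pi * j / (K + 1 : ℕ)))) / (K + 1) := by
    rw [sampleMean, Finset.range_eq_Ico, Finset.sum_eq_sum_Ico_succ_bot (Nat.succ_pos K)]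
    simp
  have hfin : ∑ k ∈ s, r k * (heightFun ε k - 2 / ((K + 1) * (1 - k))) =
      sampleMean (K + 1) (R * E) - (R * E).eval 1 / (K + 1) := by
    rw [hmean, hone, Finset.sum_div, ← Finset.sum_sub_distrib]
    refine Finset.sum_congr rfl fun k hk => ?_
    have : (1 - k : ℝ) ≠ 0 := sub_ne_zero.2 (hs k hk).symm
    field_simp
  rw [hfin, hsplit]
  field_simp
  ring

/-! ### Crossings of the imaginary axis -/

theorem crossPoly_eval_neg_one {K : ℕ} (ε : Fin K → ℝ) : (crossPoly ε).eval (-1) = 0 := by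
  have := eval_crossPoly_cos ε Real.pi
  rw [Real.cos_pi, Real.sin_pi] at this
  rw [this]; ring

theorem half_arccos_mem_Ioo {x : ℝ} (hx : x ∈ Set.Ioo (-1 : ℝ) 1) :
    Real.arccos x / 2 ∈ Set.Ioo 0 (Real.pi / 2) := by
  have h0 := Real.arccos_pos.2 hx.2
  have h1 : Real.arccos x < Real.pi :=
    (Real.arccos_le_pi x).lt_of_ne fun h => by rw [Real.arccos_eq_pi] at h; linarith [hx.1]
  exact ⟨by linarith, by linarith⟩

theorem cos_two_mul_half_arccos {x : ℝ} (hx : x ∈ Set.Icc (-1 : ℝ) 1) :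
    Real.cos (2 * (Real.arccos x / 2)) = x := by
  rw [mul_div_cancel₀ _ two_ne_zero, Real.cos_arccos hx.1 hx.2]

theorem sin_half_arccos_sq {x : ℝ} (hx : x ∈ Set.Icc (-1 : ℝ) 1) :
    Real.sin (Real.arccos x / 2) ^ 2 = (1 - x) / 2 := by
  rw [Real.sin_sq_eq_half_sub, cos_two_mul_half_arccos hx]; ring

/-- At a zero of `crossPoly` the curve meets the imaginary axis. -/
theorem transfer_exp_half_arccos {K : ℕ} {ε : Fin K → ℝ} {x : ℝ} (hx : x ∈ Set.Ioo (-1 : ℝ) 1)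
    (h0 : (crossPoly ε).eval x = 0) :
    transfer ε (Complex.exp ((Real.arccos x / 2 : ℝ) * Complex.I)) =
      (Real.sin (Real.arccos x / 2) * heightFun ε x : ℝ) * Complex.I := by
  have ht := half_arccos_mem_Ioo hx
  have h2 := cos_two_mul_half_arccos (Set.Ioo_subset_Icc_self hx)
  have hc : 0 < Real.cos (Real.arccos x / 2) :=
    Real.cos_pos_of_mem_Ioo ⟨by linarith [ht.1, Real.pi_pos], ht.2⟩
  have hre := transfer_exp_re ε (Real.arccos x / 2)
  have him := transfer_exp_im ε (Real.arccos x / 2)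
  rw [h2, h0] at hre
  rw [h2] at him
  apply Complex.ext
  · rw [(mul_eq_zero.1 hre).resolve_left (by positivity), Complex.re_ofReal_mul]; simp
  · rw [him, Complex.im_ofReal_mul]; simp

theorem transfer_I {K : ℕ} (ε : Fin K → ℝ) :
    transfer ε Complex.I = (heightFun ε (-1) : ℝ) * Complex.I := by
  have him := transfer_exp_im ε (Real.pi / 2)
  have hre := transfer_mul_I_re ε 1
  push_cast at him hre
  rw [Complex.exp_pi_div_two_mul_I, Real.sin_pi_div_two, one_mul, mul_div_cancel₀ _ two_ne_zero,
    Real.cos_pi] at him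
  rw [one_mul] at hre
  apply Complex.ext
  · rw [hre, Complex.re_ofReal_mul]; simp
  · rw [him, Complex.im_ofReal_mul]; simp

/-- If the curve misses a point `y i` of the positive imaginary axis, then `crossPoly` has a sign
change at each point of `Z`, at least half of which (those outside `M`) decrease the argument. -/
theorem exists_crossing_data {K : ℕ} {ε : Fin K → ℝ} {y : ℝ} (hy : 0 < y)
    (hne : ∀ w : ℂ, ‖w‖ ≤ 1 → transfer ε w ≠ y * Complex.I) :
    ∃ (Z M : Finset ℝ) (E : ℝ[X]), M ⊆ Z ∧ (∀ z ∈ Z, z ∈ Set.Ioo (-1 : ℝ) 1) ∧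
      crossPoly ε = (∏ z ∈ insert (-1) Z, (X - C z)) * E ∧
      (∀ x ∈ Set.Icc (-1 : ℝ) 1, 0 ≤ E.eval x) ∧
      (Z.card = 2 * M.card ∨ Z.card = 2 * M.card + 1) ∧ heightFun ε (-1) < y ∧
      ∀ z ∈ Z, z ∉ M →
        (-1 : ℝ) ^ (aboveSet Z z).card *
          (Real.sin (Real.arccos z / 2) * heightFun ε z - y) < 0 := by
  have hpi := Real.pi_pos
  obtain ⟨α, hα, hα0, hrep⟩ := exists_transfer_arg ε hy hne
  have hα1 := transfer_arg_one hy hα hα0 hrep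
  have hαI := transfer_arg_I hne hα hα0 fun w hw => (hrep w hw).1
  have hcirc : ∀ t : ℝ, ‖Complex.exp (t * Complex.I)‖ ≤ 1 := fun t =>
    (Complex.norm_exp_ofReal_mul_I t).le
  have hpos : ∀ w : ℂ, ‖w‖ ≤ 1 → 0 < ‖transfer ε w - y * Complex.I‖ := fun w hw =>
    norm_pos_iff.2 (sub_ne_zero.2 (hne w hw))
  set β : ℝ → ℝ := fun t => α (Complex.exp (t * Complex.I)) with hβ
  have hβc : ContinuousOn β (Set.Icc 0 (Real.pi / 2)) :=
    hα.comp (f := fun t : ℝ => Complex.exp (t * Complex.I)) (by fun_prop) fun t _ => by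
      simp
  have hβ0 : |β 0| ≤ Real.pi / 2 := by simpa [hβ] using hα1
  have hβI : β (Real.pi / 2) = -(Real.pi / 2) := by
    simp only [hβ]; push_cast; rw [Complex.exp_pi_div_two_mul_I, hαI]
  obtain ⟨D, hD⟩ := dvd_iff_isRoot.2 (crossPoly_eval_neg_one ε)
  have hD0 : D ≠ 0 := by
    rintro rfl
    have := crossPoly_eval_one ε
    rw [hD] at this; simp at this
  obtain ⟨Z, E, hZ, hDE, hE⟩ := exists_sign_change_factorization D hD0
  have hZneg : (-1 : ℝ) ∉ Z := fun h => by simpa using (hZ _ h).1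
  have hB : crossPoly ε = (∏ z ∈ insert (-1) Z, (X - C z)) * E := by
    rw [Finset.prod_insert hZneg, mul_assoc, ← hDE, ← hD]
  have hBe : ∀ x, (crossPoly ε).eval x = (x + 1) * ((∏ z ∈ Z, (x - z)) * E.eval x) := by
    intro x; rw [hD, hDE]; simp [eval_prod]
  -- The sign is decided at 1, where `crossPoly` equals 2 and the other factors are positive.
  have hE' : ∀ x ∈ Set.Icc (-1 : ℝ) 1, 0 ≤ E.eval x := by
    refine hE.resolve_right fun h => ?_
    have h1 := hBe 1
    rw [crossPoly_eval_one] at h1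
    have h2 : 0 < ∏ z ∈ Z, (1 - z) := Finset.prod_pos fun z hz => by linarith [(hZ z hz).2]
    nlinarith [h 1 (by simp)]
  have hBz : ∀ z ∈ Z, (crossPoly ε).eval z = 0 := fun z hz => by
    rw [hBe, Finset.prod_eq_zero hz (sub_self z)]; ring
  have hht : ∀ z ∈ Z, Real.cos (β (Real.arccos z / 2)) = 0 ∧
      Real.sin (Real.arccos z / 2) * heightFun ε z - y =
        ‖transfer ε (Complex.exp ((Real.arccos z / 2 : ℝ) * Complex.I)) - y * Complex.I‖ *
          Real.sin (β (Real.arccos z / 2)) := by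
    intro z hz
    have h1 := hrep _ (hcirc (Real.arccos z / 2))
    have h2 := transfer_exp_half_arccos (hZ z hz) (hBz z hz)
    constructor
    · have h3 := h1.1
      rw [congrArg Complex.re h2, Complex.re_ofReal_mul, Complex.I_re, mul_zero] at h3
      exact (mul_eq_zero.1 h3.symm).resolve_left (hpos _ (hcirc _)).ne'
    · have h3 := h1.2
      rw [congrArg Complex.im h2, Complex.im_ofReal_mul, Complex.I_im, mul_one] at h3
      exact h3
  have hsign : ∀ t ∈ Set.Icc 0 (Real.pi / 2),
      0 ≤ (-1 : ℝ) ^ (aboveSet Z (Real.cos (2 * t))).card * Real.cos (β t) := by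
    intro t ht
    -- At `t = π/2` the factor `cos t` cannot be cancelled; the known final argument is used
    -- instead.
    rcases eq_or_lt_of_le ht.2 with h | h
    · rw [h, hβI]; simp
    have hc : 0 < Real.cos t := Real.cos_pos_of_mem_Ioo ⟨by linarith [ht.1], h⟩
    have h1 := (hrep _ (hcirc t)).1
    have h2 := transfer_exp_re ε t
    rw [h1, hBe] at h2
    have hx : Real.cos (2 * t) ∈ Set.Icc (-1 : ℝ) 1 := Real.cos_mem_Icc _
    have h3 := neg_one_pow_card_aboveSet_mul_prod Z (Real.cos (2 * t))
    have h4 : 0 ≤ ∏ z ∈ Z, |Real.cos (2 * t) - z| := Finset.prod_nonneg fun _ _ => abs_nonneg _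
    have h5 : 0 < 2 * Real.cos t * ‖transfer ε (Complex.exp (t * Complex.I)) - y * Complex.I‖ :=
      mul_pos (by positivity) (hpos _ (hcirc t))
    refine nonneg_of_mul_nonneg_right (a := 2 * Real.cos t *
      ‖transfer ε (Complex.exp (t * Complex.I)) - y * Complex.I‖) ?_ h5
    have h6 : 2 * Real.cos t * ‖transfer ε (Complex.exp (t * Complex.I)) - y * Complex.I‖ *
        ((-1 : ℝ) ^ (aboveSet Z (Real.cos (2 * t))).card * Real.cos (β t)) =
        (Real.cos (2 * t) + 1) * ((∏ z ∈ Z, |Real.cos (2 * t) - z|) *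
          E.eval (Real.cos (2 * t))) := by
      rw [← h3]
      linear_combination ((-1 : ℝ) ^ (aboveSet Z (Real.cos (2 * t))).card) * h2
    rw [h6]
    exact mul_nonneg (by linarith [hx.1]) (mul_nonneg h4 (hE' _ hx))
  refine ⟨Z, risingSet Z β, E, Finset.filter_subset _ _, hZ, hB, hE', ?_, ?_, ?_⟩
  -- The final argument `-π/2` belongs only to the sheets 0 and -1.
  · have h1 := abs_sub_sheetIndex_le hZ hβc hβ0 (fun z hz => (hht z hz).1) hsign
      (Set.right_mem_Icc.2 (by positivity))
    have h2 : ∀ Y ⊆ Z, aboveSet Y (-1) = Y := fun Y hY =>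
      Finset.filter_true_of_mem fun z hz => (hZ z (hY hz)).1
    rw [mul_div_cancel₀ _ two_ne_zero, Real.cos_pi, sheetIndex, h2 Z subset_rfl,
      h2 (risingSet Z β) (Finset.filter_subset _ _), hβI, abs_le] at h1
    have h3 : (2 * (risingSet Z β).card - Z.card : ℤ) ≤ 0 := by
      by_contra hcon
      have : (1 : ℝ) ≤ ((2 * (risingSet Z β).card - Z.card : ℤ) : ℝ) := by
        exact_mod_cast (by omega : (1 : ℤ) ≤ 2 * (risingSet Z β).card - Z.card)
      nlinarith
    have h4 : (-1 : ℤ) ≤ (2 * (risingSet Z β).card - Z.card : ℤ) := by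
      by_contra hcon
      have : ((2 * (risingSet Z β).card - Z.card : ℤ) : ℝ) ≤ -2 := by
        exact_mod_cast (by omega : (2 * (risingSet Z β).card - Z.card : ℤ) ≤ -2)
      nlinarith
    omega
  · have h1 := (hrep Complex.I (by simp)).2
    rw [hαI, Real.sin_neg, Real.sin_pi_div_two, transfer_I, Complex.im_ofReal_mul] at h1
    have h2 := hpos Complex.I (by simp)
    rw [transfer_I] at h2
    simp only [Complex.I_im, mul_one] at h1
    linarith
  · intro z hz hzM
    have hzM' : (-1 : ℝ) ^ (aboveSet Z z).card * Real.sin (β (Real.arccos z / 2)) ≤ 0 := by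
      by_contra h
      exact hzM (Finset.mem_filter.2 ⟨hz, not_le.1 h⟩)
    obtain ⟨h1, h2⟩ := hht z hz
    have h3 : Real.sin (β (Real.arccos z / 2)) ≠ 0 := fun h => by
      have := Real.sin_sq_add_cos_sq (β (Real.arccos z / 2))
      rw [h, h1] at this; norm_num at this
    have h4 : (-1 : ℝ) ^ (aboveSet Z z).card * Real.sin (β (Real.arccos z / 2)) < 0 :=
      lt_of_le_of_ne hzM' (mul_ne_zero (by positivity) h3)
    rw [h2, mul_left_comm]
    exact mul_neg_of_pos_of_neg (hpos _ (hcirc _)) h4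

/-! ### The lower bound for the prehistory -/

/-- Heights in `(b, 1)` are forbidden. For even `n` the crossing is below `y`, hence at height at
most `b ≤ 1/(K+1)`; for odd `n` it is above, hence at height at least 1, and the derivative sign
brings in `lt_heightFun_of_derivative_nonpos`. -/
theorem neg_one_pow_mul_heightFun_sub_neg {K : ℕ} {ε : Fin K → ℝ} (hε : ∀ j, |ε j| ≤ 1) {b y : ℝ}
    (hb : b ≤ 1 / (K + 1)) (hb0 : 0 < b) (hby : b < y) (hy : y < 1)
    (hav : ∀ w : ℂ, ‖w‖ ≤ 1 → ∀ v ∈ Set.Ioo b 1, transfer ε w ≠ (v : ℝ) * Complex.I)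
    {z : ℝ} (hz : z ∈ Set.Ioo (-1 : ℝ) 1) (h0 : (crossPoly ε).eval z = 0) {n : ℕ}
    (hd : 0 ≤ (-1 : ℝ) ^ n * (derivative (crossPoly ε)).eval z)
    (hn : (-1 : ℝ) ^ n * (Real.sin (Real.arccos z / 2) * heightFun ε z - y) < 0) :
    (-1 : ℝ) ^ n * (heightFun ε z - 2 / ((K + 1) * (1 - z))) < 0 := by
  have ht := half_arccos_mem_Ioo hz
  have hs2 := sin_half_arccos_sq (Set.Ioo_subset_Icc_self hz)
  have hs : 0 < Real.sin (Real.arccos z / 2) :=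
    Real.sin_pos_of_pos_of_lt_pi ht.1 (by linarith [ht.2, Real.pi_pos])
  have hS : ¬ Real.sin (Real.arccos z / 2) * heightFun ε z ∈ Set.Ioo b 1 := fun h =>
    hav _ (Complex.norm_exp_ofReal_mul_I _).le _ h (transfer_exp_half_arccos hz h0)
  set s := Real.sin (Real.arccos z / 2)
  set W := heightFun ε z
  have hz1 : 0 < 1 - z := by linarith [hz.2]
  have hK : (0 : ℝ) < K + 1 := by positivity
  have hs1 : s < 1 := by nlinarith [hz.1]
  rcases n.even_or_odd with h | h <;> rw [h.neg_one_pow] at hn hd ⊢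
  · have hSb : s * W ≤ b := by
      by_contra hcon
      exact hS ⟨not_le.1 hcon, by linarith⟩
    have h1 : W < 2 / ((K + 1) * (1 - z)) := by
      have h2 : s * W * (K + 1) ≤ 1 := by
        have := (le_div_iff₀ hK).1 (hSb.trans hb)
        exact this
      have h3 : 2 / ((K + 1) * (1 - z)) = 1 / ((K + 1) * s ^ 2) := by
        rw [hs2]; field_simp
      rw [h3, lt_div_iff₀ (by positivity)]
      nlinarith
    linarith
  · have hS1 : 1 ≤ s * W := by
      by_contra hcon
      exact hS ⟨by linarith, not_le.1 hcon⟩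
    have hW : 0 < W := pos_of_mul_pos_right (by linarith) hs.le
    have := lt_heightFun_of_derivative_nonpos hε hz h0 (by linarith) hW (by
      rw [div_le_iff₀ hz1]
      have : (s * W) ^ 2 = (1 - z) / 2 * W ^ 2 := by rw [mul_pow, hs2]
      nlinarith)
    linarith

/-- In the crossing identity all left terms are nonpositive, those of `Z \ M` negative, and the
right side is nonnegative. So `Z ⊆ M`, the count of `M` empties `Z`, and both sides vanish. -/
theorem crossings_eq_empty {K : ℕ} {ε : Fin K → ℝ} (hε : ∀ j, |ε j| ≤ 1) {b : ℝ}
    (hb0 : 0 < b) (hb : b ≤ 1 / (K + 1)) (hb1 : b < 1)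
    (hav : ∀ w : ℂ, ‖w‖ ≤ 1 → ∀ v ∈ Set.Ioo b 1, transfer ε w ≠ (v : ℝ) * Complex.I) :
    b = 1 / (K + 1) ∧ ∃ E : ℝ[X], crossPoly ε = (X + 1) * E ∧
      (∀ x ∈ Set.Icc (-1 : ℝ) 1, 0 ≤ E.eval x) ∧
      ∀ j ∈ Finset.Ico 1 (K + 1), E.eval (Real.cos (2 * Real.pi * j / (K + 1 : ℕ))) = 0 := by
  set y := (b + 1) / 2 with hy
  have hby : b < y := by linarith
  have hy1 : y < 1 := by linarith
  obtain ⟨Z, M, E, hMZ, hZ, hB, hE, hcard, hI, hfall⟩ :=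
    exists_crossing_data (ε := ε) (hb0.trans hby) fun w hw => hav w hw y ⟨hby, hy1⟩
  have hK : (0 : ℝ) < K + 1 := by positivity
  have hZneg : (-1 : ℝ) ∉ Z := fun h => by simpa using (hZ _ h).1
  have hIb : heightFun ε (-1) ≤ b := by
    by_contra hcon
    exact hav Complex.I (by simp) _ ⟨not_le.1 hcon, by linarith⟩ (transfer_I ε)
  -- For odd `Z.card` the Lagrange weight at `-1` has the wrong sign; the factor `X + 1` kills that
  -- term.
  set Q : ℝ[X] := if Odd Z.card then X + 1 else 1 with hQ
  -- Double zeros discard the crossings in `M` and keep `R` nonnegative; the degree is exactly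
  -- `Z.card`, the largest allowed.
  set R : ℝ[X] := (∏ z ∈ M, (X - C z) ^ 2) * Q with hR
  have hQpos : ∀ x, -1 < x → 0 < Q.eval x := by
    intro x hx
    rw [hQ]; split_ifs <;> simp; linarith
  have hRnonneg : ∀ x ∈ Set.Icc (-1 : ℝ) 1, 0 ≤ R.eval x := by
    intro x hx
    rw [hR, eval_mul, eval_prod]
    refine mul_nonneg (Finset.prod_nonneg fun z _ => ?_) ?_
    · simp only [eval_pow]; positivity
    · rw [hQ]; split_ifs <;> simp; linarith [hx.1]
  have hRpos : ∀ z ∈ Z, z ∉ M → 0 < R.eval z := by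
    intro z hz hzM
    rw [hR, eval_mul, eval_prod]
    refine mul_pos (Finset.prod_pos fun l hl => ?_) (hQpos z (hZ z hz).1)
    have : z - l ≠ 0 := sub_ne_zero.2 fun h => hzM (h ▸ hl)
    simp only [eval_pow, eval_sub, eval_X, eval_C]; positivity
  have hRM : ∀ z ∈ M, R.eval z = 0 := by
    intro z hz
    rw [hR, eval_mul, eval_prod, Finset.prod_eq_zero hz (by simp), zero_mul]
  have hRdeg : R.degree < (insert (-1) Z).card := by
    rw [Finset.card_insert_of_notMem hZneg]
    have h1 : (∏ z ∈ M, (X - C z) ^ 2 : ℝ[X]).natDegree = 2 * M.card := by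
      rw [natDegree_prod_of_monic _ _ fun z _ => (monic_X_sub_C z).pow 2]
      simp [mul_comm]
    have h2 : R.natDegree ≤ Z.card := by
      refine natDegree_mul_le.trans ?_
      rw [h1, hQ]
      split_ifs with hodd
      · have : (X + 1 : ℝ[X]).natDegree = 1 := natDegree_X_add_C 1
        rw [this]
        rcases hcard with h | h
        · exact absurd hodd (by rw [h, Nat.not_odd_iff_even]; exact even_two_mul _)
        · omega
      · rw [natDegree_one]; omega
    exact degree_le_natDegree.trans_lt (by exact_mod_cast Nat.lt_succ_of_le h2)
  have hid := sum_crossing_identity (fun k hk => by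
    rcases Finset.mem_insert.1 hk with h | h
    · rw [h]; norm_num
    · exact (hZ k h).2.ne) hB hRdeg
  have hrhs : ∀ j ∈ Finset.Ico 1 (K + 1),
      0 ≤ (R * E).eval (Real.cos (2 * Real.pi * j / (K + 1 : ℕ))) := fun j _ => by
    rw [eval_mul]
    exact mul_nonneg (hRnonneg _ (Real.cos_mem_Icc _)) (hE _ (Real.cos_mem_Icc _))
  have hBz : ∀ z ∈ Z, crossPoly ε = (X - C z) * ((∏ l ∈ (insert (-1) Z).erase z, (X - C l)) * E) :=
    fun z hz => by
      rw [hB, ← mul_assoc, Finset.mul_prod_erase _ (fun l => X - C l) (Finset.mem_insert_of_mem hz)]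
  have hprod : ∀ z ∈ Z,
      0 < (-1 : ℝ) ^ (aboveSet Z z).card * ∏ l ∈ (insert (-1) Z).erase z, (z - l) := by
    intro z hz
    have hz1 := (hZ z hz).1
    rw [Finset.erase_insert_of_ne hz1.ne,
      Finset.prod_insert fun h => hZneg (Finset.mem_of_mem_erase h), mul_left_comm,
      ← aboveSet_erase_self, neg_one_pow_card_aboveSet_mul_prod]
    refine mul_pos (by linarith) (Finset.prod_pos fun l hl => ?_)
    exact abs_pos.2 (sub_ne_zero.2 (Finset.ne_of_mem_erase hl).symm)
  have hsq : ∀ n : ℕ, (-1 : ℝ) ^ n * (-1) ^ n = 1 := fun n => by rw [← mul_pow]; norm_num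
  have hZterm : ∀ z ∈ Z, z ∉ M → R.eval z * (∏ l ∈ (insert (-1) Z).erase z, (z - l)⁻¹) *
      (heightFun ε z - 2 / ((K + 1) * (1 - z))) < 0 := by
    intro z hz hzM
    have hp := hprod z hz
    have hder : (derivative (crossPoly ε)).eval z =
        (∏ l ∈ (insert (-1) Z).erase z, (z - l)) * E.eval z := by
      rw [hBz z hz]; simp [derivative_mul, eval_prod]
    have hneg := neg_one_pow_mul_heightFun_sub_neg hε hb hb0 hby hy1 hav (hZ z hz)
      (by rw [hBz z hz]; simp) (n := (aboveSet Z z).card)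
      (by rw [hder, ← mul_assoc]
          exact mul_nonneg hp.le (hE z (Set.Ioo_subset_Icc_self (hZ z hz))))
      (hfall z hz hzM)
    rw [Finset.prod_inv_distrib]
    have h1 : 0 < (-1 : ℝ) ^ (aboveSet Z z).card *
        (∏ l ∈ (insert (-1) Z).erase z, (z - l))⁻¹ := by
      have h2 : ((-1 : ℝ) ^ (aboveSet Z z).card)⁻¹ = (-1 : ℝ) ^ (aboveSet Z z).card := by
        rw [← inv_pow]; norm_num
      have h3 := inv_pos.2 hp
      rwa [mul_inv, h2] at h3
    have h4 := mul_neg_of_pos_of_neg (mul_pos (hRpos z hz hzM) h1) hneg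
    calc _ = R.eval z * (∏ l ∈ (insert (-1) Z).erase z, (z - l))⁻¹ *
        (heightFun ε z - 2 / ((K + 1) * (1 - z))) *
          ((-1 : ℝ) ^ (aboveSet Z z).card * (-1) ^ (aboveSet Z z).card) := by
          rw [hsq, mul_one]
      _ < 0 := by linarith
  have hZle : ∀ z ∈ Z, R.eval z * (∏ l ∈ (insert (-1) Z).erase z, (z - l)⁻¹) *
      (heightFun ε z - 2 / ((K + 1) * (1 - z))) ≤ 0 := by
    intro z hz
    by_cases hzM : z ∈ M
    · rw [hRM z hzM]; simp
    · exact (hZterm z hz hzM).le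
  have hhalf : (2 : ℝ) / ((K + 1) * (1 - -1)) = 1 / (K + 1) := by
    field_simp; norm_num
  have hIle : R.eval (-1) * (∏ l ∈ (insert (-1) Z).erase (-1), (-1 - l)⁻¹) *
      (heightFun ε (-1) - 2 / ((K + 1) * (1 - -1))) ≤ 0 := by
    rw [hhalf]
    refine mul_nonpos_of_nonneg_of_nonpos ?_ (by linarith)
    by_cases hodd : Odd Z.card
    · have : R.eval (-1) = 0 := by rw [hR, eval_mul, hQ, if_pos hodd]; simp
      rw [this]; simp
    · refine mul_nonneg (hRnonneg _ (by norm_num)) ?_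
      rw [Finset.erase_insert hZneg, Finset.prod_inv_distrib, inv_nonneg]
      have h1 := neg_one_pow_card_aboveSet_mul_prod Z (-1)
      have h2 : aboveSet Z (-1) = Z := Finset.filter_true_of_mem fun z hz => (hZ z hz).1
      rw [h2, (Nat.not_odd_iff_even.1 hodd).neg_one_pow, one_mul] at h1
      rw [h1]
      exact Finset.prod_nonneg fun _ _ => abs_nonneg _
  have hsumZ := Finset.sum_nonpos hZle
  have hsumR := Finset.sum_nonneg hrhs
  rw [Finset.sum_insert hZneg] at hid
  have hrhs0 := div_nonneg hsumR hK.le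
  have hMZ' : Z ⊆ M := by
    intro z hz
    by_contra hzM
    have := Finset.sum_lt_sum hZle ⟨z, hz, hZterm z hz hzM⟩
    rw [Finset.sum_const_zero] at this
    linarith
  have hM : M = Z := hMZ.antisymm hMZ'
  have hZe : Z = ∅ := by rw [← Finset.card_eq_zero]; rw [hM] at hcard; omega
  subst hZe
  subst hM
  have hR1 : R = 1 := by simp [hR, hQ]
  rw [hR1] at hid hsumR hrhs hrhs0
  simp only [Finset.sum_empty, add_zero, one_mul, eval_one] at hid hsumR hrhs hrhs0
  have hpe : ∏ l ∈ (insert (-1) (∅ : Finset ℝ)).erase (-1), (-1 - l)⁻¹ = 1 := by simp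
  rw [hpe, one_mul, hhalf] at hid
  refine ⟨by linarith, E, by rw [hB]; simp, hE, ?_⟩
  have h0 : (∑ j ∈ Finset.Ico 1 (K + 1),
      E.eval (Real.cos (2 * Real.pi * j / (K + 1 : ℕ)))) / (K + 1) = 0 := by linarith
  rw [div_eq_zero_iff, or_iff_left hK.ne'] at h0
  exact (Finset.sum_eq_zero_iff_of_nonneg hrhs).1 h0

/-- A curve that avoids the segment from `b i` to `i`, with `b ≤ 1 / (K + 1)`, exists only for
`K = 1` and `b = 1 / 2`. -/
theorem eq_one_and_eq_half_of_avoids {K : ℕ} {ε : Fin K → ℝ} (hε : ∀ j, |ε j| ≤ 1) {b : ℝ}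
    (hb0 : 0 < b) (hb : b ≤ 1 / (K + 1)) (hb1 : b < 1)
    (hav : ∀ w : ℂ, ‖w‖ ≤ 1 → ∀ v ∈ Set.Ioo b 1, transfer ε w ≠ (v : ℝ) * Complex.I) :
    K = 1 ∧ b = 1 / 2 := by
  obtain ⟨hbK, E, hB, hE, hzero⟩ := crossings_eq_empty hε hb0 hb hb1 hav
  have hpi := Real.pi_pos
  rcases Nat.lt_or_ge K 2 with h | h
  · interval_cases K
    · norm_num at hbK; linarith
    · exact ⟨rfl, by rw [hbK]; norm_num⟩
  exfalso
  have hN : (3 : ℝ) ≤ K + 1 := by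
    have : (2 : ℝ) ≤ K := by exact_mod_cast h
    linarith
  have hN0 : (0 : ℝ) < K + 1 := by linarith
  set t := Real.pi / (K + 1) with ht
  set x := Real.cos (2 * t) with hx
  have ht0 : 0 < t := by positivity
  have ht3 : t ≤ Real.pi / 3 := div_le_div_of_nonneg_left hpi.le (by norm_num) hN
  have hEx : E.eval x = 0 := by
    have := hzero 1 (Finset.mem_Ico.2 ⟨le_rfl, by omega⟩)
    rw [hx, ht]
    convert this using 3
    push_cast; ring
  have hs0 : 0 < Real.sin t := Real.sin_pos_of_pos_of_lt_pi ht0 (by linarith)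
  have hc0 : 0 < Real.cos t := Real.cos_pos_of_mem_Ioo ⟨by linarith, by linarith⟩
  have hsc := Real.sin_sq_add_cos_sq t
  have hxs : x = 1 - 2 * Real.sin t ^ 2 := by rw [hx, Real.cos_two_mul]; linarith
  have hxmem : x ∈ Set.Ioo (-1 : ℝ) 1 := ⟨by nlinarith, by nlinarith⟩
  -- A nonnegative polynomial has a double zero at an interior zero.
  have hder : (derivative E).eval x = 0 := by
    have hmin : IsLocalMin (fun u => E.eval u) x := by
      filter_upwards [Icc_mem_nhds hxmem.1 hxmem.2] with u hu
      rw [hEx]; exact hE u hu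
    rw [← Polynomial.deriv]; exact hmin.deriv_eq_zero
  obtain ⟨E₁, hE₁⟩ := dvd_iff_isRoot.2 hEx
  have hE₁x : E₁.eval x = 0 := by
    rw [hE₁] at hder; simpa [derivative_mul] using hder
  have hBG : crossPoly ε = (X - C x) * ((X + 1) * E₁) := by rw [hB, hE₁]; ring
  -- The quotient vanishes at every node except 1, so its mean, hence the height, is explicit.
  have hW := sampleMean_of_crossPoly_eq hBG
  have hG1 : ((X + 1) * E₁).eval 1 = 1 / Real.sin t ^ 2 := by
    have := congrArg (eval 1) hBG
    rw [crossPoly_eval_one, eval_mul, eval_sub, eval_X, eval_C, hxs] at this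
    rw [eq_div_iff (by positivity)]
    linarith
  have hG0 : ∀ j ∈ Finset.Ico 1 (K + 1),
      ((X + 1) * E₁).eval (Real.cos (2 * Real.pi * j / (K + 1 : ℕ))) = 0 := by
    intro j hj
    have h1 := hzero j hj
    rw [hE₁, eval_mul, eval_sub, eval_X, eval_C] at h1
    rw [eval_mul]
    rcases mul_eq_zero.1 h1 with h2 | h2
    · rw [sub_eq_zero.1 h2, hE₁x, mul_zero]
    · rw [h2, mul_zero]
  rw [sampleMean, Finset.range_eq_Ico, Finset.sum_eq_sum_Ico_succ_bot (Nat.succ_pos K),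
    Finset.sum_eq_zero hG0, add_zero] at hW
  simp only [Nat.cast_zero, mul_zero, zero_div, Real.cos_zero] at hW
  rw [hG1] at hW
  push_cast at hW
  have hBx : (crossPoly ε).eval x = 0 := by rw [hBG]; simp
  have harc : Real.arccos x / 2 = t := by
    rw [hx, Real.arccos_cos (by linarith) (by linarith)]; ring
  have htr := transfer_exp_half_arccos hxmem hBx
  rw [harc] at htr
  have hS : Real.sin t * heightFun ε x = 1 / ((K + 1) * Real.sin t) := by
    rw [← hW]; field_simp
  refine hav _ (Complex.norm_exp_ofReal_mul_I t).le _ ?_ htr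
  rw [hS, hbK]
  have hs1 : Real.sin t < 1 := by nlinarith
  -- Jordan's inequality puts the height at most at `1/2`.
  have hjordan : 2 ≤ (K + 1) * Real.sin t := by
    have h1 := Real.mul_le_sin ht0.le (by linarith)
    have h2 : 2 / Real.pi * t = 2 / (K + 1) := by rw [ht]; field_simp
    rw [h2, div_le_iff₀ hN0] at h1
    linarith
  constructor
  · exact one_div_lt_one_div_of_lt (by positivity) (by nlinarith)
  · rw [div_lt_one (by positivity)]; linarith

theorem eq_one_and_eq_four_of_transferAvoids {K : ℕ} {ε : Fin K → ℝ} (hε : ∀ j, |ε j| < 1)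
    {μs : ℝ} (hμs : 1 < μs) (hK : (K : ℝ) + 1 ≤ √μs) (hav : TransferAvoids ε μs) :
    K = 1 ∧ μs = 4 := by
  have hs1 : 1 < √μs := Real.lt_sqrt_of_sq_lt (by linarith)
  have hs0 : 0 < √μs := by linarith
  have hsq : √μs ^ 2 = μs := Real.sq_sqrt (by linarith)
  have hK0 : (0 : ℝ) < K + 1 := by positivity
  obtain ⟨h1, h2⟩ := eq_one_and_eq_half_of_avoids (b := 1 / √μs) (fun j => (hε j).le)
    (by positivity) (one_div_le_one_div_of_le hK0 hK) (by rw [div_lt_one hs0]; exact hs1)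
    fun w hw v hv hvw => by
      have hv0 : 0 < v := lt_trans (by positivity) hv.1
      have h3 : 1 < v * √μs := (div_lt_iff₀ hs0).1 hv.1
      -- The multiplier solving `μ (v i)² = 1`; `1/√μs < v < 1` says that it lies in `(-μs, -1)`.
      refine hav w hw (-(1 / v ^ 2)) ⟨?_, ?_⟩ ?_
      · rw [neg_lt_neg_iff, div_lt_iff₀ (by positivity), ← hsq]
        nlinarith
      · rw [neg_lt_neg_iff, lt_div_iff₀ (by positivity)]
        nlinarith [hv.2]
      · have hvc : (v : ℂ) ≠ 0 := by exact_mod_cast hv0.ne'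
        rw [hvw, mul_pow, Complex.I_sq]
        push_cast
        field_simp
  refine ⟨h1, ?_⟩
  have : √μs = 2 := by field_simp at h2; linarith
  rw [← hsq, this]; norm_num

/-! ### Assembly of the two bounds -/

theorem corollary3 (μs : ℝ) (hμs : 1 < μs) (N₀ : ℕ)
    (hN₀ : IsLeast {n : ℕ | Real.sqrt μs < (n : ℝ)} N₀) :
    (∃ ε : Fin (N₀ - 1) → ℝ, (∀ j, |ε j| < 1) ∧ StabilizesAllCycles μs ε) ∧
    (μs ≠ 4 → IsLeast (stabilizingDepths μs) (2 * (N₀ - 1))) ∧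
    (μs = 4 → IsLeast (stabilizingDepths μs) 2) := by
  have hlt : √μs < N₀ := hN₀.1
  have hs1 : 1 < √μs := Real.lt_sqrt_of_sq_lt (by linarith)
  have hN1 : 1 < N₀ := by exact_mod_cast hs1.trans hlt
  have hex : ∃ ε : Fin (N₀ - 1) → ℝ, (∀ j, |ε j| < 1) ∧ StabilizesAllCycles μs ε := by
    have hcast : ((N₀ - 1 : ℕ) : ℝ) + 1 = N₀ := by
      exact_mod_cast (by omega : N₀ - 1 + 1 = N₀)
    have hNpos : (0 : ℝ) < N₀ := by linarith
    have hdiff : 1 / (N₀ : ℝ) < 1 / √μs := one_div_lt_one_div_of_lt (by linarith) hlt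
    have hle : 1 / √μs < 1 := by rw [div_lt_one (by linarith)]; exact hs1
    have hNinv : 0 < 1 / (N₀ : ℝ) := by positivity
    -- The whole slack in `√μs < N₀`, so that `(1 - η) / N₀ + η ≤ 1 / √μs`.
    set η := 1 / √μs - 1 / (N₀ : ℝ) with hη
    have h0 : 0 < η := by linarith
    have h1 : η ≤ 1 := by linarith
    refine ⟨fejerGain (N₀ - 1) η, abs_fejerGain_lt_one _ h0.le h1,
      stabilizesAllCycles_of_transferAvoids
        (fun j hj => weight_fejerGain_nonneg _ h0.le h1 hj)
        (transferAvoids_fejerGain_of_pos h0 h1 (by linarith) ?_)⟩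
    rw [hcast]
    have : (1 - η) / N₀ ≤ 1 / N₀ := div_le_div_of_nonneg_right (by linarith) hNpos.le
    linarith
  refine ⟨hex, fun h4 => ⟨⟨N₀, hN1.le, rfl, hex⟩, ?_⟩, fun h4 => ⟨?_, ?_⟩⟩
  · rintro d ⟨N, hN, rfl, ε, hε, hst⟩
    by_contra hcon
    have hle : (N : ℝ) ≤ √μs := by
      by_contra h
      have := hN₀.2 (show N ∈ {n : ℕ | √μs < (n : ℝ)} from not_le.1 h)
      omega
    refine h4 (eq_one_and_eq_four_of_transferAvoids hε hμs ?_
      (transferAvoids_of_stabilizesAllCycles hst)).2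
    have hcast : ((N - 1 : ℕ) : ℝ) + 1 = N := by exact_mod_cast (by omega : N - 1 + 1 = N)
    rwa [hcast]
  · subst h4
    exact ⟨2, by norm_num, rfl, fejerGain 1 0, abs_fejerGain_lt_one 1 le_rfl zero_le_one,
      stabilizesAllCycles_of_transferAvoids
        (fun j hj => weight_fejerGain_nonneg 1 le_rfl zero_le_one hj)
        transferAvoids_fejerGain_one_four⟩
  · rintro d ⟨N, hN, rfl, ε, hε, hst⟩
    by_contra hcon
    -- Depth below 2 means no gains at all, `K = 0`, which the lower bound excludes.
    obtain rfl : N = 1 := by omega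
    have := (eq_one_and_eq_four_of_transferAvoids hε hμs (by simpa using hs1.le)
      (transferAvoids_of_stabilizesAllCycles hst)).1
    simp at this
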